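/- **Conventions on simplicial complexes.** A simplicial complex $\Delta$ on a finite set $V$ is a set of subsets of $V$ (its faces) that is closed under taking subsets; its facets are the inclusion-maximal faces, and it is pure if all facets have the same cardinality; $\dim F=|F|-1$. A simplex is the complex $\langle F\rangle$ of all subsets of some $F\subseteq V$; the void complex (without faces) also counts as a simplex. For $I\subseteq V$ put $$\mathrm{del}_\Delta(I)=\{J\in\Delta: I\not\subseteq J\},\qquad \mathrm{star}_\Delta(I)=\{J: I\cup J\in\Delta\},\qquad \mathrm{link}_\Delta(I)=\{J: I\cup J\in\Delta,\ I\cap J=\emptyset\},$$ and let $\mathrm{costar}_\Delta(I)$ be the complex generated by the facets of $\Delta$ that do not contain $I$. - $\Delta$ is *vertex decomposable* if it is a simplex, or it is pure and has a vertex $v$ such that $\mathrm{del}_\Delta(\{v\})$ and $\mathrm{link}_\Delta(\{v\})$ are vertex decomposable. - $\Delta$ is *shellable* if it is a simplex, or it is pure and has a facet $F$ such that $\mathrm{costar}_\Delta(F)$ is shellable and $\langle F\rangle\cap\mathrm{costar}_\Delta(F)$ is pure of dimension $\dim F-1$. - $\Delta$ is *strongly vertex decomposable* (respectively *strongly shellable*)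 if for every face $I\in\Delta$, including $I=\emptyset$, both $\mathrm{star}_\Delta(I)$ and $\mathrm{costar}_\Delta(I)$ are vertex decomposable (respectively shellable). - $\Delta$ is *spherical* if its geometric realization $\bigcup_{I\in\Delta}\mathrm{conv}\{e_i: i\in I\}\subset\mathbb R^V$ is homeomorphic to a sphere $S^{d-1}\subset\mathbb R^d$ for some $d\ge 0$ (where $S^{-1}=\emptyset$). **Subword complexes.** Let $(W,S)$ be a Coxeter system, $Q=(q_1,\dots,q_r)$ a word in the generators $S$ and $\pi\in W$. The subword complex $\Delta(Q,\pi)$ is the simplicial complex on $\{1,\dots,r\}$ whose facets are the sets $I$ such that the subword of $Q$ formed by the letters at the positions not in $I$ is a reduced expression for $\pi$. It is of *finite type* if $W$ is finite. **Theorem.** Let $(W,S)$ be a Coxeter system with $W$ finite, $Q$ a word in $S$ and $\pi\in W$, and suppose that the subword complex $\Delta(Q,\pi)$ is spherical. Then $\Delta(Q,\pi)$ is strongly vertex decomposable: for every face $I$, both its star and its costar are vertex decomposable. Hence $\Delta(Q,\pi)$ is strongly shellable. -/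

import Mathlib

namespace SubwordComplex

/-- A simplicial complex on `V`: a set of (finite) subsets of `V` that is closed under passing to
subsets. The empty set is a face of every complex except the void complex `⊥`, which has no
faces at all. -/
abbrev Complex (V : Type*) := LowerSet (Finset V)

section Complexes

variable {V : Type*} [DecidableEq V]

/-- Facets are the inclusion-maximal faces. -/
def IsFacet (Δ : Complex V) (F : Finset V) : Prop := Maximal (· ∈ Δ) F

/-- All facets have the same dimension. -/
def IsPure (Δ : Complex V) : Prop :=
  ∀ F G : Finset V, IsFacet Δ F → IsFacet Δ G → F.card = G.card

/-- The complex `⟨{F}⟩` of all subsets of `F`. -/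
def simplexOn (F : Finset V) : Complex V := LowerSet.Iic F

/-- A simplex: the complex of all subsets of one finite set, or the void complex (which, as is
customary for shellings, counts as a simplex). -/
def IsSimplex (Δ : Complex V) : Prop := Δ = ⊥ ∨ ∃ F : Finset V, Δ = simplexOn F

/-- The deletion of the face `I`: all faces that do not contain `I`. -/
def deletion (Δ : Complex V) (I : Finset V) : Complex V where
  carrier := {J | J ∈ Δ ∧ ¬ I ⊆ J}
  lower' := fun _ _ hba ha => ⟨Δ.lower hba ha.1, fun h => ha.2 (h.trans hba)⟩

/-- The star of `I`: all faces `J` with `I ∪ J` a face. -/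
def star (Δ : Complex V) (I : Finset V) : Complex V where
  carrier := {J | I ∪ J ∈ Δ}
  lower' := fun _ _ hba ha => Δ.lower (Finset.union_subset_union_right hba) ha

/-- The link of `I`: all faces `J` of the star of `I` that are disjoint from `I`. -/
def link (Δ : Complex V) (I : Finset V) : Complex V where
  carrier := {J | I ∪ J ∈ Δ ∧ I ∩ J = ∅}
  lower' := fun _ _ hba ha =>
    ⟨Δ.lower (Finset.union_subset_union_right hba) ha.1,
      Finset.subset_empty.mp ((Finset.inter_subset_inter_left hba).trans ha.2.le)⟩

/-- The costar of `I`: the complex generated by the facets that do not contain `I`. -/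
def costar (Δ : Complex V) (I : Finset V) : Complex V where
  carrier := {J | ∃ F, IsFacet Δ F ∧ J ⊆ F ∧ ¬ I ⊆ F}
  lower' := fun _ _ hba ⟨F, hF, haF, hI⟩ => ⟨F, hF, hba.trans haF, hI⟩

/-- A complex is shellable if it is a simplex, or it is pure and has a facet `F` such that the
complex generated by the other facets is shellable and meets `F` in a complex that is pure of
dimension `dim F - 1`. -/
inductive Shellable : Complex V → Prop
  | simplex (Δ : Complex V) (h : IsSimplex Δ) : Shellable Δ
  | step (Δ : Complex V) (F : Finset V) (hpure : IsPure Δ) (hF : IsFacet Δ F)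
      (hcostar : Shellable (costar Δ F))
      (hinter : ∀ G : Finset V, IsFacet (simplexOn F ⊓ costar Δ F) G → G.card + 1 = F.card) :
      Shellable Δ

/-- A complex is vertex decomposable if it is a simplex, or it is pure and has a vertex `v` whose
deletion and whose link are both vertex decomposable. -/
inductive VertexDecomposable : Complex V → Prop
  | simplex (Δ : Complex V) (h : IsSimplex Δ) : VertexDecomposable Δ
  | step (Δ : Complex V) (v : V) (hpure : IsPure Δ) (hv : {v} ∈ Δ)
      (hdel : VertexDecomposable (deletion Δ {v}))
      (hlink : VertexDecomposable (link Δ {v})) :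
      VertexDecomposable Δ

/-- For every face, both its costar and its star are shellable. -/
def StronglyShellable (Δ : Complex V) : Prop :=
  ∀ I ∈ Δ, Shellable (costar Δ I) ∧ Shellable (star Δ I)

/-- For every face, both its costar and its star are vertex decomposable. -/
def StronglyVertexDecomposable (Δ : Complex V) : Prop :=
  ∀ I ∈ Δ, VertexDecomposable (costar Δ I) ∧ VertexDecomposable (star Δ I)

/-- The standard geometric realization of a complex on a finite set `V`: the union, over the
faces `I`, of the convex hulls of the standard basis vectors `e i`, `i ∈ I`, of `ℝ^V`. -/
def realization [Finite V] (Δ : Complex V) : Set (V → ℝ) :=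
  ⋃ I ∈ Δ, convexHull ℝ ((fun i : V => (Pi.single i 1 : V → ℝ)) '' (I : Set V))

/-- The geometric realization is homeomorphic to a sphere `S^(d-1)`, the unit sphere of `ℝ^d`,
for some `d ≥ 0`. (For `d = 0` this is the empty space `S^(-1)`, the realization of `{∅}`.) -/
def IsSpherical [Finite V] (Δ : Complex V) : Prop :=
  ∃ d : ℕ, Nonempty (realization Δ ≃ₜ Metric.sphere (0 : EuclideanSpace ℝ (Fin d)) 1)

end Complexes

section Subwords

variable {B W : Type*} [Group W] {M : CoxeterMatrix B}

/-- The subword `Q_J` of `Q` of the letters with positions in `J`, in their order in `Q`. -/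
def subword (Q : List B) (J : Finset (Fin Q.length)) : List B :=
  ((List.finRange Q.length).filter (· ∈ J)).map Q.get

/-- The word `ω` is a reduced expression for `w`. -/
def IsReducedExpression (cs : CoxeterSystem M W) (ω : List B) (w : W) : Prop :=
  cs.IsReduced ω ∧ cs.wordProd ω = w

/-- The subword complex `Δ(Q, w)` on the set of positions of `Q`: the complex generated by the
sets `I` of positions whose complement spells a reduced expression for `w`. -/
def subwordComplex (cs : CoxeterSystem M W) (Q : List B) (w : W) : Complex (Fin Q.length) where
  carrier := {J | ∃ I, J ⊆ I ∧ IsReducedExpression cs (subword Q Iᶜ) w}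
  lower' := fun _ _ hba ⟨I, haI, hI⟩ => ⟨I, hba.trans haI, hI⟩

end Subwords

end SubwordComplex

/-!
Write `δ(Q)` for the Demazure product of the word `Q` (`demazureProd`), the Bruhat maximum of the
products of its subwords (`wordProd_bruhatLE_demazureProd`; the Bruhat order rests on the strong
exchange property, `mem_rightInvSeq_of_length_lt`). If `Δ(Q, w)` has a face, so that `Q` contains a
reduced expression for `w`, there are two cases.

If `δ(Q) ≠ w`, then `Δ(Q, w)` is collapsible (`collapsible_wordComplex`, by induction on `Q`: the
link and the deletion of the last position are complexes of the same kind). Its realization is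
then contractible (`Collapsible.contractibleSpace_realization`), whereas no sphere is
(`not_contractibleSpace_sphere`, by the analytic proof of Milnor and Rogers). So this case does not
occur for a spherical complex.

If `δ(Q) = w`, then every face that avoids a position `v` lies in a facet that avoids `v`
(`exists_isFacet_wordComplex_notMem`). Moreover the deletion of any position is vertex decomposable
(`vertexDecomposable_deletion_wordComplex`): complete `Q` by a reduced word for `w⁻¹ w₀` to a word
for the longest element `w₀`, and rotate that word until the position comes first; the deletion
is now a subword complex for the remaining letters, and all subword complexes are vertex
decomposable (`vertexDecomposable_wordComplex`). Since links are subword complexes with the same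
Demazure product, it follows by induction on `I` that the costar of `I` is vertex decomposable:
for `v ∈ I`, its deletion at `v` is that of the whole complex and its link at `v` is the costar of
`I \ {v}` in the link of `v`. Stars are treated in the same way, and vertex decomposable complexes
are shellable (`VertexDecomposable.shellable`).
-/

namespace SubwordComplex

/-! ### The strong exchange property -/

section StrongExchange

variable {B W : Type*} [Group W] {M : CoxeterMatrix B} (cs : CoxeterSystem M W)

open Classical in
/-- The action of a simple reflection `s` on pairs `(t, ε)`: `t` is conjugated by `s`, and the sign
`ε` is flipped exactly when `t = s`. -/
noncomputable def signedConj (i : B) : Equiv.Perm (W × ZMod 2) :=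
  Function.Involutive.toPerm
    (fun p => (cs.simple i * p.1 * cs.simple i, p.2 + if p.1 = cs.simple i then 1 else 0)) <| by
    rintro ⟨t, ε⟩
    have h : cs.simple i * t * cs.simple i = cs.simple i ↔ t = cs.simple i := by
      constructor
      · intro h
        have := congrArg (cs.simple i * ·) h
        have h' := congrArg (· * cs.simple i) this
        simpa [mul_assoc] using h'
      · rintro rfl; simp
    ext1
    · simp [mul_assoc]
    · simp only [h, add_assoc, CharTwo.add_self_eq_zero, add_zero]

open Classical in
lemma signedConj_apply (i : B) (t : W) (ε : ZMod 2) :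
    signedConj cs i (t, ε) =
      (cs.simple i * t * cs.simple i, ε + if t = cs.simple i then 1 else 0) := rfl

lemma inv_simple_mul_simple_pow_mul (i j : B) (k : ℕ) :
    ((cs.simple i * cs.simple j) ^ k)⁻¹ * cs.simple j =
      cs.simple j * (cs.simple i * cs.simple j) ^ k := by
  induction k with
  | zero => simp
  | succ k ih =>
    rw [pow_succ', mul_inv_rev, mul_assoc]
    have : (cs.simple i * cs.simple j)⁻¹ * cs.simple j =
        cs.simple j * (cs.simple i * cs.simple j) := by simp [mul_assoc]
    rw [this, ← mul_assoc, ih, mul_assoc, ← pow_succ, pow_succ']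

open Classical in
lemma signedConj_pow_apply (i j : B) (k : ℕ) (t : W) (ε : ZMod 2) :
    ((signedConj cs i * signedConj cs j) ^ k) (t, ε) =
      ((cs.simple i * cs.simple j) ^ k * t * ((cs.simple i * cs.simple j) ^ k)⁻¹,
        ε + ∑ l ∈ Finset.range (2 * k),
          if t = cs.simple j * (cs.simple i * cs.simple j) ^ l then 1 else 0) := by
  induction k with
  | zero => simp
  | succ k ih =>
    rw [pow_succ', Equiv.Perm.mul_apply, ih]
    set r := cs.simple i * cs.simple j with hr
    have h0 : r ^ k * t * (r ^ k)⁻¹ = cs.simple j ↔ t = cs.simple j * r ^ (2 * k) := by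
      rw [two_mul, pow_add, ← mul_assoc, ← inv_simple_mul_simple_pow_mul, mul_inv_eq_iff_eq_mul,
        ← eq_inv_mul_iff_mul_eq, mul_assoc]
    have h1 : cs.simple j * (r ^ k * t * (r ^ k)⁻¹) * cs.simple j = cs.simple i ↔
        t = cs.simple j * r ^ (2 * k + 1) := by
      have e1 : cs.simple j * r ^ (2 * k + 1) = (r ^ k)⁻¹ * (cs.simple j * r) * r ^ k := by
        rw [← mul_assoc ((r ^ k)⁻¹), inv_simple_mul_simple_pow_mul, ← hr, mul_assoc, mul_assoc,
          ← pow_succ', ← pow_add]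
        congr 2; omega
      rw [e1]
      have e2 : cs.simple j * r = cs.simple j * cs.simple i * cs.simple j := by
        rw [hr, mul_assoc]
      rw [e2]
      constructor
      · intro h; rw [← h]; simp [mul_assoc]
      · intro h; rw [h]; simp [mul_assoc]
    simp only [Equiv.Perm.mul_apply, signedConj_apply]
    ext1
    · simp [hr, pow_succ', mul_assoc]
    · simp only [h0, h1]
      rw [show 2 * (k + 1) = 2 * k + 1 + 1 by ring, Finset.sum_range_succ, Finset.sum_range_succ]
      simp only [add_assoc]

lemma signedConj_isLiftable : M.IsLiftable (signedConj cs) := by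
  classical
  intro i j
  ext1 ⟨t, ε⟩
  rw [signedConj_pow_apply]
  have : ∑ l ∈ Finset.range (2 * M i j),
      (if t = cs.simple j * (cs.simple i * cs.simple j) ^ l then (1 : ZMod 2) else 0) = 0 := by
    rw [two_mul, Finset.sum_range_add]
    simp only [pow_add, cs.simple_mul_simple_pow, one_mul]
    exact CharTwo.add_self_eq_zero _
  rw [this]
  simp

/-- The action of `W` on pairs `(t, ε)` extending `signedConj`. -/
noncomputable def signedAction : W →* Equiv.Perm (W × ZMod 2) :=
  cs.lift ⟨signedConj cs, signedConj_isLiftable cs⟩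

open Classical in
/-- The action of `w` flips the sign attached to `t` according to the parity of the number of
times `t` occurs in the right inversion sequence of any word for `w`. -/
lemma signedAction_wordProd (ω : List B) (t : W) (ε : ZMod 2) :
    signedAction cs (cs.wordProd ω) (t, ε) =
      (cs.wordProd ω * t * (cs.wordProd ω)⁻¹, ε + ((cs.rightInvSeq ω).count t : ZMod 2)) := by
  induction ω with
  | nil => simp
  | cons i ω ih =>
    rw [cs.wordProd_cons, map_mul, Equiv.Perm.mul_apply, ih]
    have : signedAction cs (cs.simple i) = signedConj cs i := by
      unfold signedAction; exact cs.lift_apply_simple (signedConj_isLiftable cs) i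
    rw [this, signedConj_apply, CoxeterSystem.rightInvSeq, List.count_cons]
    ext1
    · simp [mul_assoc]
    · have e : (cs.wordProd ω * t * (cs.wordProd ω)⁻¹ = cs.simple i) ↔
          ((cs.wordProd ω)⁻¹ * cs.simple i * cs.wordProd ω = t) := by
        constructor
        · intro h; rw [← h]; group
        · intro h; rw [← h]; group
      simp only [e, beq_iff_eq, add_assoc]
      push_cast
      rfl

lemma signedAction_reflection {t : W} (ht : cs.IsReflection t) (ε : ZMod 2) :
    signedAction cs t (t, ε) = (t, ε + 1) := by
  classical
  obtain ⟨v, i, rfl⟩ := ht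
  obtain ⟨ω, -, rfl⟩ := cs.exists_isReduced v
  set v := cs.wordProd ω
  set c : ZMod 2 := ((cs.rightInvSeq ω).count (cs.simple i) : ZMod 2)
  have h1 (ε) : signedAction cs v (cs.simple i, ε) = (v * cs.simple i * v⁻¹, ε + c) :=
    signedAction_wordProd cs ω _ _
  have h2 : signedAction cs v⁻¹ (v * cs.simple i * v⁻¹, ε) = (cs.simple i, ε - c) := by
    have := h1 (ε - c)
    rw [sub_add_cancel] at this
    rw [← this, ← Equiv.Perm.mul_apply, ← map_mul, inv_mul_cancel, map_one, Equiv.Perm.one_apply]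
  rw [map_mul, map_mul, Equiv.Perm.mul_apply, Equiv.Perm.mul_apply, h2]
  have : signedAction cs (cs.simple i) = signedConj cs i := by
    unfold signedAction; exact cs.lift_apply_simple (signedConj_isLiftable cs) i
  rw [this, signedConj_apply]
  simp only [cs.simple_mul_simple_self, one_mul, if_true]
  rw [h1]
  ext1
  · rfl
  · simp only; ring

/-- The strong exchange property: a reflection that shortens `w` occurs in the right inversion
sequence of every word for `w`, reduced or not. -/
theorem mem_rightInvSeq_of_length_lt (ω : List B) {t : W} (ht : cs.IsReflection t)
    (hlt : cs.length (cs.wordProd ω * t) < cs.length (cs.wordProd ω)) :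
    t ∈ cs.rightInvSeq ω := by
  classical
  by_contra hmem
  obtain ⟨ω', hω', he⟩ := cs.exists_isReduced (cs.wordProd ω * t)
  have h1 := signedAction_wordProd cs ω' t 0
  rw [← he, map_mul, Equiv.Perm.mul_apply, signedAction_reflection cs ht,
    signedAction_wordProd, List.count_eq_zero_of_not_mem hmem] at h1
  have h2 := congrArg Prod.snd h1
  simp only [zero_add, Nat.cast_zero, add_zero] at h2
  have h3 : t ∈ cs.rightInvSeq ω' := by
    by_contra h
    rw [List.count_eq_zero_of_not_mem h] at h2
    simp at h2
  have h4 := (cs.isRightInversion_of_mem_rightInvSeq hω' h3).2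
  rw [← he, mul_assoc, ht.mul_self, mul_one] at h4
  omega

/-- The strong exchange property: a reflection that shortens `w` deletes one letter from every
word for `w`. -/
theorem exists_eraseIdx_of_length_lt (ω : List B) {t : W} (ht : cs.IsReflection t)
    (hlt : cs.length (cs.wordProd ω * t) < cs.length (cs.wordProd ω)) :
    ∃ j < ω.length, cs.wordProd ω * t = cs.wordProd (ω.eraseIdx j) := by
  obtain ⟨j, hj, he⟩ := List.mem_iff_getElem.mp (mem_rightInvSeq_of_length_lt cs ω ht hlt)
  refine ⟨j, by simpa using hj, ?_⟩
  rw [← cs.wordProd_mul_getD_rightInvSeq, List.getD_eq_getElem _ _ hj, he]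

end StrongExchange

/-! ### The Bruhat order -/

section Bruhat

variable {B W : Type*} [Group W] {M : CoxeterMatrix B} (cs : CoxeterSystem M W)

/-- The Bruhat order: `u ≤ v` if `v` is reached from `u` by successive right multiplications by
reflections, each of which increases the length. -/
def BruhatLE : W → W → Prop :=
  Relation.ReflTransGen fun u v => ∃ t, cs.IsReflection t ∧ v = u * t ∧ cs.length u < cs.length v

variable {cs}

lemma BruhatLE.length_le {u v : W} (h : BruhatLE cs u v) : cs.length u ≤ cs.length v := by
  induction h with
  | refl => exact le_rfl
  | tail _ h ih => obtain ⟨t, -, -, hlt⟩ := h; omega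

lemma bruhatLE_mul_simple {u : W} {i : B} (h : ¬ cs.IsRightDescent u i) :
    BruhatLE cs u (u * cs.simple i) := by
  refine Relation.ReflTransGen.single ⟨_, cs.isReflection_simple i, rfl, ?_⟩
  rw [cs.not_isRightDescent_iff] at h
  omega

lemma mul_simple_bruhatLE {u : W} {i : B} (h : cs.IsRightDescent u i) :
    BruhatLE cs (u * cs.simple i) u :=
  Relation.ReflTransGen.single ⟨_, cs.isReflection_simple i, by simp, h⟩

/-- The lifting property of the Bruhat order. -/
theorem BruhatLE.mul_simple {u v : W} (h : BruhatLE cs u v) (i : B) :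
    BruhatLE cs (u * cs.simple i) v ∨ BruhatLE cs (u * cs.simple i) (v * cs.simple i) := by
  induction h using Relation.ReflTransGen.head_induction_on with
  | refl => exact Or.inr Relation.ReflTransGen.refl
  | @head u x hux hxv ih =>
    obtain ⟨t, ht, rfl, hlt⟩ := hux
    by_cases hts : t = cs.simple i
    · subst hts; exact Or.inl hxv
    by_cases hd : cs.IsRightDescent u i
    · exact Or.inl ((mul_simple_bruhatLE hd).trans
        (Relation.ReflTransGen.head ⟨t, ht, rfl, hlt⟩ hxv))
    have key : cs.length (u * cs.simple i) < cs.length (u * t * cs.simple i) := by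
      by_contra hnot
      obtain ⟨ω, hω, rfl⟩ := cs.exists_isReduced u
      -- the reflection that carries `u * s` to `u * t * s`
      have ht' : cs.IsReflection (cs.simple i * t * cs.simple i) := by
        simpa using ht.conj (cs.simple i)
      have e : cs.wordProd (ω ++ [i]) * (cs.simple i * t * cs.simple i) =
          cs.wordProd ω * t * cs.simple i := by
        simp [cs.wordProd_append, mul_assoc]
      have hlt' : cs.length (cs.wordProd (ω ++ [i]) * (cs.simple i * t * cs.simple i)) <
          cs.length (cs.wordProd (ω ++ [i])) := by
        refine lt_of_le_of_ne ?_ (ht'.length_mul_left_ne _)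
        rw [e, cs.wordProd_append, cs.wordProd_singleton]
        omega
      obtain ⟨j, hj, hje⟩ := exists_eraseIdx_of_length_lt cs (ω ++ [i]) ht' hlt'
      rw [e] at hje
      rcases lt_or_ge j ω.length with hj' | hj'
      · rw [List.eraseIdx_append_of_lt_length hj', cs.wordProd_append, cs.wordProd_singleton,
          mul_left_inj] at hje
        have h1 := cs.length_wordProd_le (ω.eraseIdx j)
        rw [← hje, List.length_eraseIdx_of_lt hj'] at h1
        rw [hω.eq] at hlt
        omega
      · -- deleting the last letter `s` would force `t = s`
        have : j = ω.length := by simp at hj; omega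
        subst this
        rw [List.eraseIdx_append_of_length_le le_rfl] at hje
        simp only [Nat.sub_self, List.eraseIdx_cons_zero, List.append_nil, mul_assoc] at hje
        exact hts (by simpa [mul_eq_one_iff_eq_inv] using hje)
    have hstep : BruhatLE cs (u * cs.simple i) (u * t * cs.simple i) :=
      Relation.ReflTransGen.single ⟨cs.simple i * t * cs.simple i,
        by simpa using ht.conj (cs.simple i), by simp [mul_assoc], key⟩
    rcases ih with h | h
    · exact Or.inl (hstep.trans h)
    · exact Or.inr (hstep.trans h)

end Bruhat

/-! ### The Demazure product -/

section Demazure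

variable {B W : Type*} [Group W] {M : CoxeterMatrix B} (cs : CoxeterSystem M W)

open Classical in
/-- The Demazure product of a word: letters are multiplied from left to right, and a letter that
would decrease the length is skipped. -/
noncomputable def demazureProd (Q : List B) : W :=
  Q.foldl (fun u i => if cs.IsRightDescent u i then u else u * cs.simple i) 1

open Classical in
lemma demazureProd_append_singleton (Q : List B) (i : B) :
    demazureProd cs (Q ++ [i]) = if cs.IsRightDescent (demazureProd cs Q) i then demazureProd cs Q
      else demazureProd cs Q * cs.simple i := by
  rw [demazureProd, List.foldl_append]; rfl

lemma sublist_append_singleton {α : Type*} {l Q : List α} {i : α} (h : l.Sublist (Q ++ [i])) :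
    l.Sublist Q ∨ ∃ l', l'.Sublist Q ∧ l = l' ++ [i] := by
  obtain ⟨l₁, l₂, rfl, h₁, h₂⟩ := List.sublist_append_iff.mp h
  rcases List.sublist_cons_iff.mp h₂ with h₃ | ⟨r, rfl, h₃⟩
  · rw [List.sublist_nil.mp h₃, List.append_nil]; exact Or.inl h₁
  · rw [List.sublist_nil.mp h₃]; exact Or.inr ⟨l₁, h₁, rfl⟩

/-- The Demazure product is the Bruhat maximum of the products of subwords. -/
theorem wordProd_bruhatLE_demazureProd (Q : List B) :
    ∀ ω : List B, ω.Sublist Q → BruhatLE cs (cs.wordProd ω) (demazureProd cs Q) := by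
  induction Q using List.reverseRecOn with
  | nil =>
    intro ω h
    rw [List.sublist_nil.mp h]
    simp only [demazureProd, cs.wordProd_nil, List.foldl_nil]
    exact Relation.ReflTransGen.refl
  | append_singleton Q i ih =>
    intro ω h
    rw [demazureProd_append_singleton]
    rcases sublist_append_singleton h with h | ⟨ω', h', rfl⟩
    · split_ifs with hd
      · exact ih ω h
      · exact (ih ω h).trans (bruhatLE_mul_simple hd)
    · rw [cs.wordProd_append, cs.wordProd_singleton]
      split_ifs with hd
      · exact ((ih ω' h').mul_simple i).elim id fun h => h.trans (mul_simple_bruhatLE hd)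
      · exact ((ih ω' h').mul_simple i).elim (fun h => h.trans (bruhatLE_mul_simple hd)) id

end Demazure

/-! ### Reduced subwords -/

section Words

variable {B W : Type*} [Group W] {M : CoxeterMatrix B} (cs : CoxeterSystem M W)

/-- The word `Q` has a subword that is a reduced expression for `w`. -/
def ContainsReduced (Q : List B) (w : W) : Prop :=
  ∃ ω : List B, ω.Sublist Q ∧ IsReducedExpression cs ω w

variable {cs}

lemma isReducedExpression_iff {ω : List B} {w : W} :
    IsReducedExpression cs ω w ↔ cs.wordProd ω = w ∧ ω.length ≤ cs.length w := by
  constructor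
  · rintro ⟨h, rfl⟩; exact ⟨rfl, h.eq.ge⟩
  · rintro ⟨rfl, h⟩; exact ⟨le_antisymm (cs.length_wordProd_le ω) h, rfl⟩

lemma IsReducedExpression.length_eq {ω : List B} {w : W} (h : IsReducedExpression cs ω w) :
    ω.length = cs.length w := by
  obtain ⟨h, rfl⟩ := h; exact h.eq.symm

lemma ContainsReduced.mono {Q Q' : List B} {w : W} (h : ContainsReduced cs Q w)
    (hQ : Q.Sublist Q') : ContainsReduced cs Q' w := by
  obtain ⟨ω, h1, h2⟩ := h
  exact ⟨ω, h1.trans hQ, h2⟩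

/-- The exchange property, for subwords. -/
lemma ContainsReduced.mul_simple {Q : List B} {w : W} (h : ContainsReduced cs Q w) {i : B}
    (hd : cs.IsRightDescent w i) : ContainsReduced cs Q (w * cs.simple i) := by
  obtain ⟨ω, h1, h2⟩ := h
  have hl := h2.length_eq
  obtain ⟨-, rfl⟩ := h2
  obtain ⟨j, hj, he⟩ := exists_eraseIdx_of_length_lt cs ω (cs.isReflection_simple i) hd
  refine ⟨ω.eraseIdx j, (List.eraseIdx_sublist _ _).trans h1, isReducedExpression_iff.mpr
    ⟨he.symm, ?_⟩⟩
  rw [List.length_eraseIdx_of_lt hj]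
  rw [cs.isRightDescent_iff] at hd
  omega

open Classical in
lemma containsReduced_append_singleton {Q : List B} {i : B} {w : W} :
    ContainsReduced cs (Q ++ [i]) w ↔
      ContainsReduced cs Q (if cs.IsRightDescent w i then w * cs.simple i else w) := by
  split_ifs with hd
  · constructor
    · rintro ⟨ω, h1, h2⟩
      rcases sublist_append_singleton h1 with h1 | ⟨ω', h3, rfl⟩
      · exact ContainsReduced.mul_simple ⟨ω, h1, h2⟩ hd
      · have hl := h2.length_eq
        obtain ⟨-, rfl⟩ := h2
        refine ⟨ω', h3, isReducedExpression_iff.mpr ⟨by simp [cs.wordProd_append], ?_⟩⟩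
        rw [cs.isRightDescent_iff] at hd
        simp at hl
        omega
    · rintro ⟨ω, h1, h2⟩
      have hl := h2.length_eq
      refine ⟨ω ++ [i], h1.append_right [i], isReducedExpression_iff.mpr
        ⟨by simp [cs.wordProd_append, h2.2], ?_⟩⟩
      rw [cs.isRightDescent_iff] at hd
      simp
      omega
  · constructor
    · rintro ⟨ω, h1, h2⟩
      rcases sublist_append_singleton h1 with h1 | ⟨ω', h3, rfl⟩
      · exact ⟨ω, h1, h2⟩
      · exfalso
        have hl := h2.length_eq
        obtain ⟨-, rfl⟩ := h2
        rw [cs.not_isRightDescent_iff] at hd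
        have := cs.length_wordProd_le ω'
        simp [cs.wordProd_append] at hl hd
        omega
    · rintro ⟨ω, h1, h2⟩
      exact ⟨ω, h1.trans (List.sublist_append_left _ _), h2⟩

/-- If no subword product is longer than `w`, then every position of the word is used by some
reduced subword for `w`: inserting a letter into a reduced subword shortens its product, so by
strong exchange another letter can be dropped instead. -/
theorem ContainsReduced.exists_through {P R : List B} {i : B} {w : W}
    (hmax : ∀ ω : List B, ω.Sublist (P ++ i :: R) → cs.length (cs.wordProd ω) ≤ cs.length w)
    (h : ContainsReduced cs (P ++ i :: R) w) :
    ∃ p r : List B, p.Sublist P ∧ r.Sublist R ∧ IsReducedExpression cs (p ++ i :: r) w := by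
  obtain ⟨ω, h1, h2⟩ := h
  obtain ⟨p, r, rfl, hp, hr⟩ := List.sublist_append_iff.mp h1
  rcases List.sublist_cons_iff.mp hr with hr | ⟨r, rfl, hr'⟩
  swap
  · exact ⟨p, r, hp, hr', h2⟩
  have hl := h2.length_eq
  obtain ⟨-, rfl⟩ := h2
  have ht : cs.IsReflection ((cs.wordProd r)⁻¹ * cs.simple i * cs.wordProd r) := by
    simpa using (cs.isReflection_simple i).conj (cs.wordProd r)⁻¹
  have e : cs.wordProd (p ++ r) * ((cs.wordProd r)⁻¹ * cs.simple i * cs.wordProd r) =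
      cs.wordProd (p ++ i :: r) := by
    simp [cs.wordProd_append, cs.wordProd_cons, mul_assoc]
  have hlt : cs.length (cs.wordProd (p ++ r) *
      ((cs.wordProd r)⁻¹ * cs.simple i * cs.wordProd r)) < cs.length (cs.wordProd (p ++ r)) := by
    refine lt_of_le_of_ne ?_ (ht.length_mul_left_ne _)
    rw [e]
    exact hmax _ (hp.append (hr.cons_cons i))
  obtain ⟨j, hj, hje⟩ := exists_eraseIdx_of_length_lt cs (p ++ r) ht hlt
  rw [e] at hje
  rcases lt_or_ge j p.length with hj' | hj'
  · rw [List.eraseIdx_append_of_lt_length hj'] at hje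
    refine ⟨p.eraseIdx j, r, (List.eraseIdx_sublist _ _).trans hp, hr,
      isReducedExpression_iff.mpr ⟨?_, ?_⟩⟩
    · simp only [cs.wordProd_append, cs.wordProd_cons] at hje ⊢
      rw [← mul_assoc, mul_left_inj] at hje
      rw [← hje]; simp [mul_assoc]
    · simp [List.length_eraseIdx_of_lt hj'] at hl ⊢
      omega
  · rw [List.eraseIdx_append_of_length_le hj'] at hje
    refine ⟨p, r.eraseIdx (j - p.length), hp, (List.eraseIdx_sublist _ _).trans hr,
      isReducedExpression_iff.mpr ⟨?_, ?_⟩⟩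
    · simp only [cs.wordProd_append, cs.wordProd_cons, mul_right_inj] at hje ⊢
      rw [← hje]; simp
    · have hj2 : j - p.length < r.length := by simp at hj; omega
      simp [List.length_eraseIdx_of_lt hj2] at hl ⊢
      omega

end Words

/-! ### The longest element -/

section Longest

variable {B W : Type*} [Group W] {M : CoxeterMatrix B} {cs : CoxeterSystem M W}

lemma exists_longest (cs : CoxeterSystem M W) [Finite W] :
    ∃ w₀ : W, ∀ u, cs.length u ≤ cs.length w₀ :=
  Finite.exists_max cs.length

/-- Every reduced word is a terminal segment of some reduced word for the longest element. -/
lemma exists_mul_wordProd_eq_longest {w₀ : W} (h₀ : ∀ u, cs.length u ≤ cs.length w₀)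
    (ω : List B) (hω : cs.IsReduced ω) :
    ∃ v, v * cs.wordProd ω = w₀ ∧ cs.length v + ω.length ≤ cs.length w₀ := by
  induction ω with
  | nil => exact ⟨w₀, by simp⟩
  | cons i ω ih =>
    have hω' : cs.IsReduced ω := by simpa using hω.drop 1
    obtain ⟨v, rfl, hv⟩ := ih hω'
    obtain ⟨ν, hν, rfl⟩ := cs.exists_isReduced v
    have ht : cs.IsReflection ((cs.wordProd ω)⁻¹ * cs.simple i * cs.wordProd ω) := by
      simpa using (cs.isReflection_simple i).conj (cs.wordProd ω)⁻¹
    have hlt : cs.length (cs.wordProd (ν ++ ω) *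
        ((cs.wordProd ω)⁻¹ * cs.simple i * cs.wordProd ω)) < cs.length (cs.wordProd (ν ++ ω)) := by
      refine lt_of_le_of_ne ?_ (ht.length_mul_left_ne _)
      rw [cs.wordProd_append]
      exact h₀ _
    obtain ⟨j, hj, hje⟩ := exists_eraseIdx_of_length_lt cs (ν ++ ω) ht hlt
    have e : cs.wordProd (ν ++ ω) * ((cs.wordProd ω)⁻¹ * cs.simple i * cs.wordProd ω) =
        cs.wordProd ν * cs.simple i * cs.wordProd ω := by
      simp [cs.wordProd_append, mul_assoc]
    rw [e] at hje
    -- the deleted letter belongs to `ν`, since the word `i :: ω` is reduced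
    rcases lt_or_ge j ν.length with hj' | hj'
    · rw [List.eraseIdx_append_of_lt_length hj', cs.wordProd_append, mul_left_inj] at hje
      refine ⟨cs.wordProd ν * cs.simple i, by simp [cs.wordProd_cons, mul_assoc], ?_⟩
      have := cs.length_wordProd_le (ν.eraseIdx j)
      rw [← hje, List.length_eraseIdx_of_lt hj'] at this
      rw [hν.eq] at hv
      simp only [List.length_cons]
      omega
    · rw [List.eraseIdx_append_of_length_le hj', cs.wordProd_append, mul_assoc,
        mul_right_inj, ← cs.wordProd_cons] at hje
      have hj2 : j - ν.length < ω.length := by simp at hj; omega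
      have := cs.length_wordProd_le (ω.eraseIdx (j - ν.length))
      rw [← hje, hω.eq, List.length_eraseIdx_of_lt hj2, List.length_cons] at this
      omega

theorem length_longest_mul {w₀ : W} (h₀ : ∀ u, cs.length u ≤ cs.length w₀) (u : W) :
    cs.length (w₀ * u) + cs.length u = cs.length w₀ := by
  obtain ⟨ω, hω, he⟩ := cs.exists_isReduced u⁻¹
  obtain ⟨v, hv, hl⟩ := exists_mul_wordProd_eq_longest h₀ ω hω
  rw [← he] at hv
  have h1 : w₀ * u = v := by rw [← hv]; simp
  have h2 : cs.length u = ω.length := by rw [← cs.length_inv, he, hω.eq]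
  have h3 := cs.length_mul_le v u⁻¹
  rw [hv, cs.length_inv] at h3
  rw [h1]
  omega

lemma longest_mul_longest {w₀ : W} (h₀ : ∀ u, cs.length u ≤ cs.length w₀) : w₀ * w₀ = 1 := by
  have := length_longest_mul h₀ w₀
  exact cs.length_eq_zero_iff.mp (by omega)

lemma longest_inv {w₀ : W} (h₀ : ∀ u, cs.length u ≤ cs.length w₀) : w₀⁻¹ = w₀ :=
  inv_eq_of_mul_eq_one_left (longest_mul_longest h₀)

theorem length_mul_longest {w₀ : W} (h₀ : ∀ u, cs.length u ≤ cs.length w₀) (u : W) :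
    cs.length (u * w₀) + cs.length u = cs.length w₀ := by
  have := length_longest_mul h₀ u⁻¹
  rwa [cs.length_inv, ← cs.length_inv, mul_inv_rev, inv_inv, longest_inv h₀] at this

/-- Conjugation by the longest element permutes the simple reflections. -/
theorem exists_conj_longest {w₀ : W} (h₀ : ∀ u, cs.length u ≤ cs.length w₀) :
    ∃ ψ : B → B, ∀ ω : List B, cs.wordProd (ω.map ψ) = w₀ * cs.wordProd ω * w₀ := by
  have h (i : B) : ∃ j, w₀ * cs.simple i * w₀ = cs.simple j := by
    rw [← cs.length_eq_one_iff]
    have h1 := length_mul_longest h₀ (w₀ * cs.simple i)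
    have h2 := length_longest_mul h₀ (cs.simple i)
    rw [cs.length_simple] at h2
    omega
  choose ψ hψ using h
  refine ⟨ψ, fun ω => ?_⟩
  induction ω with
  | nil => simp [longest_mul_longest h₀]
  | cons i ω ih =>
    rw [List.map_cons, cs.wordProd_cons, ih, ← hψ, cs.wordProd_cons]
    have := longest_mul_longest h₀
    calc w₀ * cs.simple i * w₀ * (w₀ * cs.wordProd ω * w₀)
        = w₀ * cs.simple i * (w₀ * w₀) * cs.wordProd ω * w₀ := by group
      _ = _ := by rw [this]; group

end Longest

/-! ### Faces and facets -/

section Complexes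

variable {V : Type*}

lemma mem_deletion {Δ : Complex V} {I J : Finset V} : J ∈ deletion Δ I ↔ J ∈ Δ ∧ ¬ I ⊆ J :=
  Iff.rfl

lemma mem_costar {Δ : Complex V} {I J : Finset V} :
    J ∈ costar Δ I ↔ ∃ F, IsFacet Δ F ∧ J ⊆ F ∧ ¬ I ⊆ F := Iff.rfl

lemma mem_simplexOn {F J : Finset V} : J ∈ simplexOn F ↔ J ⊆ F := Iff.rfl

lemma exists_isFacet [Finite V] {Δ : Complex V} {J : Finset V} (hJ : J ∈ Δ) :
    ∃ F, IsFacet Δ F ∧ J ⊆ F := by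
  obtain ⟨F, h1, h2⟩ := (Set.toFinite (Δ : Set (Finset V))).exists_le_maximal hJ
  exact ⟨F, h2, h1⟩

lemma IsFacet.eq_of_subset {Δ : Complex V} {F G : Finset V} (hF : IsFacet Δ F) (hG : G ∈ Δ)
    (h : F ⊆ G) : F = G :=
  h.antisymm (hF.2 hG h)

/-- The complex on `V` of the sets whose image under the relabelling `f` is a face of `Γ`. -/
def relabel {V' : Type*} (f : V ↪ V') (Γ : Complex V') : Complex V where
  carrier := {J | J.map f ∈ Γ}
  lower' := fun _ _ hba ha => Γ.lower (Finset.map_subset_map.mpr hba) ha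

lemma mem_relabel {V' : Type*} {f : V ↪ V'} {Γ : Complex V'} {J : Finset V} :
    J ∈ relabel f Γ ↔ J.map f ∈ Γ := Iff.rfl

lemma mem_deletion_singleton {Δ : Complex V} {v : V} {J : Finset V} :
    J ∈ deletion Δ {v} ↔ J ∈ Δ ∧ v ∉ J := by
  rw [mem_deletion, Finset.singleton_subset_iff]

lemma IsFacet.of_costar {Δ : Complex V} {I F : Finset V} (hF : IsFacet (costar Δ I) F) :
    IsFacet Δ F ∧ ¬ I ⊆ F := by
  obtain ⟨G, hG, hFG, hI⟩ := hF.1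
  obtain rfl := hF.eq_of_subset ⟨G, hG, subset_rfl, hI⟩ hFG
  exact ⟨hG, hI⟩

lemma isFacet_simplexOn {F G : Finset V} (h : IsFacet (simplexOn F) G) : G = F :=
  h.eq_of_subset (mem_simplexOn.mpr subset_rfl) h.1

variable [DecidableEq V]

lemma mem_star {Δ : Complex V} {I J : Finset V} : J ∈ star Δ I ↔ I ∪ J ∈ Δ := Iff.rfl

lemma mem_link {Δ : Complex V} {I J : Finset V} : J ∈ link Δ I ↔ I ∪ J ∈ Δ ∧ I ∩ J = ∅ := Iff.rfl

lemma mem_link_singleton {Δ : Complex V} {v : V} {J : Finset V} :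
    J ∈ link Δ {v} ↔ insert v J ∈ Δ ∧ v ∉ J := by
  rw [mem_link, ← Finset.insert_eq, ← Finset.disjoint_iff_inter_eq_empty,
    Finset.disjoint_singleton_left]

omit [DecidableEq V] in
lemma IsPure.costar {Δ : Complex V} (h : IsPure Δ) (I : Finset V) : IsPure (costar Δ I) :=
  fun F G hF hG => h F G hF.of_costar.1 hG.of_costar.1

lemma IsFacet.of_star {Δ : Complex V} {I F : Finset V} (hF : IsFacet (star Δ I) F) :
    IsFacet Δ F ∧ I ⊆ F := by
  have h1 : I ∪ F ∈ SubwordComplex.star Δ I := by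
    rw [mem_star, ← Finset.union_assoc, Finset.union_self]; exact hF.1
  have h2 := hF.eq_of_subset h1 Finset.subset_union_right
  have hI : I ⊆ F := by rw [h2]; exact Finset.subset_union_left
  refine ⟨⟨by rw [h2]; exact hF.1, fun G hG hFG => ?_⟩, hI⟩
  refine hF.2 (mem_star.mpr ?_) hFG
  rw [Finset.union_eq_right.mpr (hI.trans hFG)]
  exact hG

lemma IsPure.star {Δ : Complex V} (h : IsPure Δ) (I : Finset V) : IsPure (star Δ I) :=
  fun F G hF hG => h F G hF.of_star.1 hG.of_star.1

lemma isFacet_link_singleton {Δ : Complex V} {v : V} {F : Finset V} :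
    IsFacet (link Δ {v}) F ↔ v ∉ F ∧ IsFacet Δ (insert v F) := by
  constructor
  · intro hF
    obtain ⟨h1, h2⟩ := mem_link_singleton.mp hF.1
    refine ⟨h2, h1, fun G hG hFG => ?_⟩
    have hvG : v ∈ G := hFG (Finset.mem_insert_self v F)
    have h3 : F ⊆ G.erase v :=
      Finset.subset_erase.mpr ⟨(Finset.subset_insert v F).trans hFG, h2⟩
    have h4 := hF.eq_of_subset
      (mem_link_singleton.mpr ⟨by rwa [Finset.insert_erase hvG], Finset.notMem_erase v G⟩) h3
    rw [h4, Finset.insert_erase hvG]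
  · rintro ⟨h1, h2⟩
    refine ⟨mem_link_singleton.mpr ⟨h2.1, h1⟩, fun G hG hFG => ?_⟩
    obtain ⟨h3, h4⟩ := mem_link_singleton.mp hG
    have := h2.2 h3 (Finset.insert_subset_insert v hFG)
    exact (Finset.insert_subset_insert_iff h4).mp this

lemma IsPure.link_singleton {Δ : Complex V} (h : IsPure Δ) (v : V) : IsPure (link Δ {v}) := by
  intro F G hF hG
  rw [isFacet_link_singleton] at hF hG
  have := h _ _ hF.2 hG.2
  rw [Finset.card_insert_of_notMem hF.1, Finset.card_insert_of_notMem hG.1] at this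
  omega

lemma VertexDecomposable.isPure {Δ : Complex V} (h : VertexDecomposable Δ) : IsPure Δ := by
  cases h with
  | simplex _ h =>
    rcases h with rfl | ⟨F, rfl⟩
    · intro F G hF; exact absurd hF.1 (LowerSet.notMem_bot)
    · intro G H hG hH; rw [isFacet_simplexOn hG, isFacet_simplexOn hH]
  | step _ _ h => exact h

/-! ### Vertex decomposable complexes are shellable -/

section Shelling

variable [Finite V] {v : V} {L D Δ : Complex V}

/-- Adding one more facet `insert v F` to a shelling of `D ∪ (v * costar L F)` is a shelling step
of `D ∪ (v * L)`. -/
lemma shellable_of_facet (hvL : ∀ J ∈ L, v ∉ J) (hvD : ∀ J ∈ D, v ∉ J)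
    (hLD : D = ⊥ ∨ L ≤ D) (hLp : IsPure L) (hDp : IsPure D)
    (hcard : ∀ F G, IsFacet L F → IsFacet D G → G.card = F.card + 1)
    (hΔ : ∀ J, J ∈ Δ ↔ J ∈ D ∨ J.erase v ∈ L) {F : Finset V} (hF : IsFacet L F)
    (hinter : ∀ G, IsFacet (simplexOn F ⊓ costar L F) G → G.card + 1 = F.card)
    (ih : ∀ Δ' : Complex V, (∀ J, J ∈ Δ' ↔ J ∈ D ∨ J.erase v ∈ costar L F) → Shellable Δ') :
    Shellable Δ := by
  have hvF : v ∉ F := hvL F hF.1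
  -- the facets of `Δ` are the facets of `D` and the sets `insert v K` for facets `K` of `L`
  have facet_of_link {K : Finset V} (hK : IsFacet L K) : IsFacet Δ (insert v K) := by
    have hvK := hvL K hK.1
    refine ⟨(hΔ _).mpr (Or.inr (by rw [Finset.erase_insert hvK]; exact hK.1)), fun G hG hKG => ?_⟩
    have hvG : v ∈ G := hKG (Finset.mem_insert_self v K)
    have hG' : G.erase v ∈ L := ((hΔ G).mp hG).resolve_left fun h => hvD G h hvG
    have := hK.2 hG' (Finset.subset_erase.mpr ⟨(Finset.subset_insert v K).trans hKG, hvK⟩)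
    rw [← Finset.insert_erase hvG]
    exact Finset.insert_subset_insert v this
  have link_of_facet {K : Finset V} (hK : IsFacet Δ K) (hvK : v ∈ K) : IsFacet L (K.erase v) := by
    refine ⟨((hΔ K).mp hK.1).resolve_left fun h => hvD K h hvK, fun G hG hKG => ?_⟩
    have h1 : insert v G ∈ Δ := (hΔ _).mpr (Or.inr (by rwa [Finset.erase_insert (hvL G hG)]))
    have h2 := hK.2 h1 (Finset.subset_insert_iff.mpr hKG)
    exact Finset.subset_erase.mpr ⟨(Finset.subset_insert v G).trans h2, hvL G hG⟩
  have del_of_facet {K : Finset V} (hK : IsFacet Δ K) (hvK : v ∉ K) : IsFacet D K := by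
    have h1 : K ∈ D := by
      refine ((hΔ K).mp hK.1).resolve_right fun h => hvK ?_
      rw [Finset.erase_eq_of_notMem hvK] at h
      have h2 : insert v K ∈ Δ := (hΔ _).mpr (Or.inr (by rwa [Finset.erase_insert hvK]))
      exact hK.2 h2 (Finset.subset_insert v K) (Finset.mem_insert_self v K)
    exact ⟨h1, fun G hG hKG => hK.2 ((hΔ G).mpr (Or.inl hG)) hKG⟩
  have facet_of_del {K : Finset V} (hK : IsFacet D K) : IsFacet Δ K := by
    refine ⟨(hΔ K).mpr (Or.inl hK.1), fun G hG hKG => ?_⟩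
    have hle : L ≤ D := hLD.resolve_left fun h => by
      subst h; exact LowerSet.notMem_bot hK.1
    rcases (hΔ G).mp hG with hG | hG
    · exact hK.2 hG hKG
    · exfalso
      obtain ⟨H, hH, hGH⟩ := exists_isFacet hG
      have h1 : K ⊆ G.erase v := Finset.subset_erase.mpr ⟨hKG, hvD K hK.1⟩
      have h2 := Finset.card_le_card (h1.trans hGH)
      have h3 := hcard H K hH hK
      omega
  refine Shellable.step Δ (insert v F) ?_ (facet_of_link hF) (ih _ ?_) ?_
  · have hcard' {K : Finset V} (hK : IsFacet Δ K) : K.card = F.card + 1 := by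
      by_cases hvK : v ∈ K
      · rw [← hLp _ _ (link_of_facet hK hvK) hF, Finset.card_erase_add_one hvK]
      · exact hcard F K hF (del_of_facet hK hvK)
    intro K K' hK hK'
    rw [hcard' hK, hcard' hK']
  · intro J
    rw [mem_costar, mem_costar]
    constructor
    · rintro ⟨H, hH, hJH, hFH⟩
      by_cases hvH : v ∈ H
      · refine Or.inr ⟨H.erase v, link_of_facet hH hvH, Finset.erase_subset_erase v hJH, ?_⟩
        intro h
        exact hFH (Finset.insert_subset hvH (h.trans (Finset.erase_subset v H)))
      · exact Or.inl (D.lower hJH (del_of_facet hH hvH).1)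
    · rintro (hJ | ⟨K, hK, hJK, hFK⟩)
      · obtain ⟨G, hG, hJG⟩ := exists_isFacet hJ
        exact ⟨G, facet_of_del hG, hJG, fun h => hvD G hG.1 (h (Finset.mem_insert_self v F))⟩
      · exact ⟨insert v K, facet_of_link hK, Finset.subset_insert_iff.mpr hJK,
          fun h => hFK ((Finset.insert_subset_insert_iff hvF).mp h)⟩
  · intro G hG
    rw [Finset.card_insert_of_notMem hvF]
    obtain ⟨hGF, H, hH, hGH, hFH⟩ := hG.1
    change G ⊆ insert v F at hGF
    by_cases hvG : v ∈ G
    · have hGL : IsFacet (simplexOn F ⊓ costar L F) (G.erase v) := by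
        refine ⟨⟨Finset.subset_insert_iff.mp hGF, H.erase v, link_of_facet hH (hGH hvG),
          Finset.erase_subset_erase v hGH, fun h => hFH (Finset.insert_subset (hGH hvG)
            (h.trans (Finset.erase_subset v H)))⟩, ?_⟩
        rintro K ⟨hKF, N, hN, hKN, hFN⟩ hGK
        have h1 : insert v K ∈ simplexOn (insert v F) ⊓ costar Δ (insert v F) :=
          ⟨Finset.insert_subset_insert v hKF, insert v N, facet_of_link hN,
            Finset.insert_subset_insert v hKN,
            fun h => hFN ((Finset.insert_subset_insert_iff hvF).mp h)⟩
        have h2 := hG.2 h1 (Finset.subset_insert_iff.mpr hGK)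
        exact Finset.subset_erase.mpr ⟨(Finset.subset_insert v K).trans h2,
          fun h => hvF (hKF h)⟩
      have := hinter _ hGL
      rw [Finset.card_erase_add_one hvG] at this
      omega
    · have hGF' : G ⊆ F := by
        have := Finset.subset_insert_iff.mp hGF
        rwa [Finset.erase_eq_of_notMem hvG] at this
      rcases hLD with rfl | hLD
      · exfalso
        have hvH : v ∈ H := by
          by_contra h
          exact LowerSet.notMem_bot (del_of_facet hH h).1
        have h1 : insert v G ∈ simplexOn (insert v F) ⊓ costar Δ (insert v F) :=
          ⟨Finset.insert_subset_insert v hGF', H, hH, Finset.insert_subset hvH hGH, hFH⟩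
        exact hvG (hG.2 h1 (Finset.subset_insert v G) (Finset.mem_insert_self v G))
      · obtain ⟨N, hN, hFN⟩ := exists_isFacet (hLD hF.1)
        have h1 : F ∈ simplexOn (insert v F) ⊓ costar Δ (insert v F) :=
          ⟨Finset.subset_insert v F, N, facet_of_del hN, hFN,
            fun h => hvD N hN.1 (h (Finset.mem_insert_self v F))⟩
        rw [hG.eq_of_subset h1 hGF']

/-- If `D` and `L` are shellable, then so is `D ∪ (v * L)`, for `L ⊆ D` of codimension one, and
also the cone `v * L`, which is the case `D = ⊥`. -/
lemma shellable_union_cone (hL : Shellable L) : ∀ {D Δ : Complex V}, Shellable D →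
    (∀ J ∈ L, v ∉ J) → (∀ J ∈ D, v ∉ J) → (D = ⊥ ∨ L ≤ D) → IsPure L → IsPure D →
    (∀ F G, IsFacet L F → IsFacet D G → G.card = F.card + 1) →
    (∀ J, J ∈ Δ ↔ J ∈ D ∨ J.erase v ∈ L) → Shellable Δ := by
  induction hL with
  | simplex L hL =>
    intro D Δ hD hvL hvD hLD hLp hDp hcard hΔ
    rcases hL with rfl | ⟨F, rfl⟩
    · have : Δ = D := by
        ext J
        exact (hΔ J).trans (or_iff_left LowerSet.notMem_bot)
      rwa [this]
    · rcases hLD with rfl | hLD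
      · refine Shellable.simplex _ (Or.inr ⟨insert v F, ?_⟩)
        ext J
        refine (hΔ J).trans ((or_iff_right LowerSet.notMem_bot).trans ?_)
        exact Finset.subset_insert_iff.symm
      · have hbot {J : Finset V} : J ∉ costar (simplexOn F) F := by
          rintro ⟨G, hG, -, h⟩
          exact h (isFacet_simplexOn hG).ge
        refine shellable_of_facet (F := F) hvL hvD (Or.inr hLD) hLp hDp hcard hΔ
          ⟨mem_simplexOn.mpr subset_rfl, fun _ h _ => h⟩ (fun G hG => absurd hG.1.2 hbot) ?_
        intro Δ' hΔ'
        have : Δ' = D := by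
          ext J
          exact (hΔ' J).trans (or_iff_left hbot)
        rwa [this]
  | step L F hLp hF hcostar hinter ih =>
    intro D Δ hD hvL hvD hLD _ hDp hcard hΔ
    have hle : costar L F ≤ L := by
      rintro J ⟨G, hG, hJG, -⟩
      exact L.lower hJG hG.1
    refine shellable_of_facet hvL hvD hLD hLp hDp hcard hΔ hF hinter fun Δ' hΔ' => ?_
    exact ih hD (fun J hJ => hvL J (hle hJ)) hvD (hLD.imp id fun h => hle.trans h)
      (hLp.costar F) hDp (fun K G hK => hcard K G hK.of_costar.1) hΔ'

/-- Shell the deletion of a shedding vertex first, then the cone over its link. -/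
theorem VertexDecomposable.shellable (h : VertexDecomposable Δ) : Shellable Δ := by
  induction h with
  | simplex Δ h => exact Shellable.simplex Δ h
  | step Δ v hpure hv hdel hlink ihdel ihlink =>
    have hvL : ∀ J ∈ link Δ {v}, v ∉ J := fun J hJ => (mem_link_singleton.mp hJ).2
    have hlink' {J : Finset V} : J.erase v ∈ link Δ {v} ↔ insert v J ∈ Δ := by
      rw [mem_link_singleton, and_iff_left (Finset.notMem_erase v J)]
      by_cases hv : v ∈ J
      · rw [Finset.insert_erase hv, Finset.insert_eq_of_mem hv]
      · rw [Finset.erase_eq_of_notMem hv]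
    -- if all facets contain `v`, then `Δ` is the cone over the link and the deletion is ignored
    by_cases hcone : ∃ G, IsFacet Δ G ∧ v ∉ G
    · obtain ⟨G, hG, hvG⟩ := hcone
      have hGD : IsFacet (deletion Δ {v}) G :=
        ⟨mem_deletion_singleton.mpr ⟨hG.1, hvG⟩, fun H hH hGH => hG.2 hH.1 hGH⟩
      refine shellable_union_cone (v := v) ihlink ihdel hvL
        (fun J hJ => (mem_deletion_singleton.mp hJ).2) (Or.inr ?_) (hpure.link_singleton v)
        hdel.isPure ?_ ?_
      · intro J hJ
        obtain ⟨h1, h2⟩ := mem_link_singleton.mp hJ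
        exact mem_deletion_singleton.mpr ⟨Δ.lower (Finset.subset_insert v J) h1, h2⟩
      · intro F H hF hH
        rw [isFacet_link_singleton] at hF
        rw [hdel.isPure _ _ hH hGD, hpure _ _ hG hF.2, Finset.card_insert_of_notMem hF.1]
      · intro J
        rw [hlink', mem_deletion_singleton]
        constructor
        · intro hJ
          by_cases hvJ : v ∈ J
          · right; rwa [Finset.insert_eq_of_mem hvJ]
          · exact Or.inl ⟨hJ, hvJ⟩
        · rintro (h | h)
          · exact h.1
          · exact Δ.lower (Finset.subset_insert v J) h
    · push Not at hcone
      refine shellable_union_cone (v := v) ihlink (Shellable.simplex ⊥ (Or.inl rfl)) hvL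
        (fun J hJ => absurd hJ LowerSet.notMem_bot) (Or.inl rfl) (hpure.link_singleton v)
        (fun F G hF => absurd hF.1 LowerSet.notMem_bot)
        (fun F G _ hG => absurd hG.1 LowerSet.notMem_bot) ?_
      intro J
      rw [hlink', or_iff_right LowerSet.notMem_bot]
      constructor
      · intro hJ
        obtain ⟨F, hF, hJF⟩ := exists_isFacet hJ
        exact Δ.lower (Finset.insert_subset (hcone F hF) hJF) hF.1
      · exact fun h => Δ.lower (Finset.subset_insert v J) h

end Shelling

/-! ### Relabelling vertices -/

/-- Vertex decomposability does not depend on the labels, nor on labels that are not vertices. -/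
theorem VertexDecomposable.relabel {V' : Type*} [DecidableEq V'] (f : V ↪ V') {Γ : Complex V'}
    (h : VertexDecomposable Γ) (hΓ : ∀ J ∈ Γ, ∃ I : Finset V, J = I.map f) :
    VertexDecomposable (relabel f Γ) := by
  induction h with
  | simplex Γ h =>
    refine VertexDecomposable.simplex _ (h.imp ?_ ?_)
    · rintro rfl
      ext J
      exact iff_of_false LowerSet.notMem_bot LowerSet.notMem_bot
    · rintro ⟨F, rfl⟩
      obtain ⟨I, rfl⟩ := hΓ F (mem_simplexOn.mpr subset_rfl)
      refine ⟨I, ?_⟩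
      ext J
      exact Finset.map_subset_map
  | step Γ v hpure hv hdel hlink ihdel ihlink =>
    obtain ⟨I, hI⟩ := hΓ _ hv
    have hvI : v ∈ I.map f := by rw [← hI]; exact Finset.mem_singleton_self v
    obtain ⟨u, -, rfl⟩ := Finset.mem_map.mp hvI
    have hfacet {F : Finset V} (hF : IsFacet (SubwordComplex.relabel f Γ) F) :
        IsFacet Γ (F.map f) := by
      refine ⟨hF.1, fun G hG hFG => ?_⟩
      obtain ⟨J, rfl⟩ := hΓ G hG
      exact Finset.map_subset_map.mpr (hF.2 hG (Finset.map_subset_map.mp hFG))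
    refine VertexDecomposable.step _ u ?_ ?_ ?_ ?_
    · intro F G hF hG
      simpa using hpure _ _ (hfacet hF) (hfacet hG)
    · rw [mem_relabel, Finset.map_singleton]; exact hv
    · convert ihdel fun J hJ => hΓ J hJ.1 using 1
      ext J
      change J ∈ deletion (SubwordComplex.relabel f Γ) {u} ↔
        J.map f ∈ deletion Γ {f u}
      rw [mem_deletion_singleton, mem_deletion_singleton, mem_relabel]
      simp
    · convert ihlink fun J hJ => hΓ J
        (Γ.lower (Finset.subset_insert _ _) (mem_link_singleton.mp hJ).1) using 1
      ext J
      change J ∈ link (SubwordComplex.relabel f Γ) {u} ↔ J.map f ∈ link Γ {f u}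
      rw [mem_link_singleton, mem_link_singleton, mem_relabel, Finset.map_insert]
      simp

/-! ### Stars and costars, one vertex at a time -/

lemma link_star_singleton {Δ : Complex V} {v : V} {I : Finset V} (hv : v ∈ I) :
    link (star Δ I) {v} = star (link Δ {v}) (I.erase v) := by
  ext J
  change J ∈ link (star Δ I) {v} ↔ J ∈ star (link Δ {v}) (I.erase v)
  rw [mem_link_singleton, mem_star, mem_star, mem_link_singleton]
  have : I ∪ insert v J = insert v (I.erase v ∪ J) := by
    rw [Finset.union_insert, ← Finset.insert_union, ← Finset.insert_union, Finset.insert_erase hv,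
      Finset.insert_eq_of_mem hv]
  rw [this]
  simp

lemma deletion_star_singleton {Δ : Complex V} {v : V} {I : Finset V} (hv : v ∈ I) :
    deletion (star Δ I) {v} = star (link Δ {v}) (I.erase v) := by
  ext J
  change J ∈ deletion (star Δ I) {v} ↔ J ∈ star (link Δ {v}) (I.erase v)
  rw [mem_deletion_singleton, mem_star, mem_star, mem_link_singleton, ← Finset.insert_union,
    Finset.insert_erase hv]
  simp

lemma link_costar_singleton {Δ : Complex V} {v : V} {I : Finset V} (hv : v ∈ I) :
    link (costar Δ I) {v} = costar (link Δ {v}) (I.erase v) := by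
  ext J
  change J ∈ link (costar Δ I) {v} ↔ J ∈ costar (link Δ {v}) (I.erase v)
  rw [mem_link_singleton, mem_costar, mem_costar]
  constructor
  · rintro ⟨⟨F, hF, hJF, hIF⟩, hvJ⟩
    have hvF : v ∈ F := hJF (Finset.mem_insert_self v J)
    refine ⟨F.erase v, isFacet_link_singleton.mpr ⟨Finset.notMem_erase v F, ?_⟩,
      Finset.subset_erase.mpr ⟨(Finset.subset_insert v J).trans hJF, hvJ⟩, fun h => hIF ?_⟩
    · rwa [Finset.insert_erase hvF]
    · rw [← Finset.insert_erase hv]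
      exact Finset.insert_subset hvF (h.trans (Finset.erase_subset v F))
  · rintro ⟨F, hF, hJF, hIF⟩
    rw [isFacet_link_singleton] at hF
    refine ⟨⟨insert v F, hF.2, Finset.insert_subset_insert v hJF, fun h => hIF ?_⟩,
      fun h => hF.1 (hJF h)⟩
    exact Finset.subset_insert_iff.mp h

omit [DecidableEq V] in
lemma deletion_costar_singleton {Δ : Complex V} {v : V} {I : Finset V} (hv : v ∈ I)
    (h : ∀ J ∈ Δ, v ∉ J → ∃ F, IsFacet Δ F ∧ J ⊆ F ∧ v ∉ F) :
    deletion (costar Δ I) {v} = deletion Δ {v} := by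
  ext J
  change J ∈ deletion (costar Δ I) {v} ↔ J ∈ deletion Δ {v}
  rw [mem_deletion_singleton, mem_deletion_singleton, mem_costar]
  refine and_congr_left fun hvJ => ⟨?_, fun hJ => ?_⟩
  · rintro ⟨F, hF, hJF, -⟩
    exact Δ.lower hJF hF.1
  · obtain ⟨F, hF, hJF, hvF⟩ := h J hJ hvJ
    exact ⟨F, hF, hJF, fun h => hvF (h hv)⟩

/-- A pure complex is vertex decomposable as soon as the deletion and the link of some `v` are,
even if `v` is not a vertex of it. -/
lemma VertexDecomposable.of_deletion_link {Δ : Complex V} (v : V) (hpure : IsPure Δ)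
    (hdel : VertexDecomposable (deletion Δ {v}))
    (hlink : VertexDecomposable (link Δ {v})) : VertexDecomposable Δ := by
  by_cases hv : {v} ∈ Δ
  · exact VertexDecomposable.step Δ v hpure hv hdel hlink
  · convert hdel
    ext J
    change J ∈ Δ ↔ J ∈ deletion Δ {v}
    rw [mem_deletion_singleton]
    refine ⟨fun h => ⟨h, fun hvJ => hv (Δ.lower (Finset.singleton_subset_iff.mpr hvJ) h)⟩, And.left⟩

/-! ### Collapses -/

/-- Complexes that become cones after a sequence of collapses. Here a collapse deletes a nonempty
set `σ` from a complex in which the link of `σ` is a cone with apex `x`. -/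
inductive Collapsible : Complex V → Prop
  | cone (Δ : Complex V) (x : V) (hne : ∅ ∈ Δ) (hx : ∀ J ∈ Δ, insert x J ∈ Δ) : Collapsible Δ
  | collapse (Δ : Complex V) (σ : Finset V) (x : V) (hσ : σ.Nonempty) (hxσ : x ∉ σ)
      (hx : ∀ J ∈ Δ, σ ⊆ J → insert x J ∈ Δ) (hdel : Collapsible (deletion Δ σ)) : Collapsible Δ

/-- Collapses of the link of a vertex lift to the whole complex. -/
theorem Collapsible.of_link_deletion {v : V} {Δ : Complex V} (hlink : Collapsible (link Δ {v}))
    (hdel : Collapsible (deletion Δ {v})) : Collapsible Δ := by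
  generalize hL : link Δ {v} = L at hlink
  induction hlink generalizing Δ with
  | cone L x hne hx =>
    subst hL
    have hvx : x ≠ v := by
      rintro rfl
      exact (mem_link_singleton.mp (hx _ hne)).2 (Finset.mem_insert_self _ _)
    refine Collapsible.collapse Δ {v} x (Finset.singleton_nonempty v) (by simpa using hvx) ?_ hdel
    intro J hJ hvJ
    rw [Finset.singleton_subset_iff] at hvJ
    have h1 : J.erase v ∈ link Δ {v} :=
      mem_link_singleton.mpr ⟨by rwa [Finset.insert_erase hvJ], Finset.notMem_erase v J⟩
    have h2 := (mem_link_singleton.mp (hx _ h1)).1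
    rwa [Finset.insert_comm, Finset.insert_erase hvJ] at h2
  | collapse L σ x hσ hxσ hx hd ih =>
    subst hL
    by_cases hvσ : v ∈ σ
    · -- then `σ` is no face of the link, and nothing is deleted
      refine ih hdel ?_
      ext J
      change J ∈ link Δ {v} ↔ J ∈ deletion (link Δ {v}) σ
      rw [mem_deletion]
      exact ⟨fun h => ⟨h, fun h' => (mem_link_singleton.mp h).2 (h' hvσ)⟩, And.left⟩
    by_cases hvx : x = v
    · subst hvx
      refine ih hdel ?_
      ext J
      change J ∈ link Δ {x} ↔ J ∈ deletion (link Δ {x}) σ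
      rw [mem_deletion]
      refine ⟨fun h => ⟨h, fun h' => ?_⟩, And.left⟩
      exact (mem_link_singleton.mp (hx J h h')).2 (Finset.mem_insert_self _ _)
    refine Collapsible.collapse Δ (insert v σ) x (Finset.insert_nonempty v σ) ?_ ?_ (ih ?_ ?_)
    · simp [hvx, hxσ]
    · intro J hJ hvJ
      have hvJ' : v ∈ J := hvJ (Finset.mem_insert_self v σ)
      have h1 : J.erase v ∈ link Δ {v} :=
        mem_link_singleton.mpr ⟨by rwa [Finset.insert_erase hvJ'], Finset.notMem_erase v J⟩
      have h2 := (mem_link_singleton.mp (hx _ h1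
        (Finset.subset_erase.mpr ⟨(Finset.subset_insert v σ).trans hvJ, hvσ⟩))).1
      rwa [Finset.insert_comm, Finset.insert_erase hvJ'] at h2
    · convert hdel using 1
      ext J
      change J ∈ deletion (deletion Δ (insert v σ)) {v} ↔ J ∈ deletion Δ {v}
      rw [mem_deletion_singleton, mem_deletion_singleton, mem_deletion]
      refine ⟨fun h => ⟨h.1.1, h.2⟩, fun h => ⟨⟨h.1, fun h' => ?_⟩, h.2⟩⟩
      exact h.2 (h' (Finset.mem_insert_self v σ))
    · ext J
      change J ∈ link (deletion Δ (insert v σ)) {v} ↔ J ∈ deletion (link Δ {v}) σ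
      rw [mem_link_singleton, mem_deletion, mem_deletion, mem_link_singleton,
        Finset.insert_subset_insert_iff hvσ]
      tauto

end Complexes

/-! ### Subword complexes with labelled positions -/

section WordComplex

variable {V B W : Type*} [DecidableEq V] [Group W] {M : CoxeterMatrix B}

/-- The subword complex of a word whose positions carry labels in `V`: a set `J` of labels is a
face if the letters with labels outside `J` contain a reduced expression for `w`. Labels other
than positions make it possible to delete, reorder and add letters without renumbering. -/
def wordComplex (cs : CoxeterSystem M W) (L : List (V × B)) (w : W) : Complex V where
  carrier := {J | (∀ v ∈ J, v ∈ L.map Prod.fst) ∧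
    ContainsReduced cs ((L.filter (·.1 ∉ J)).map Prod.snd) w}
  lower' := fun _ _ hba ha => ⟨fun v hv => ha.1 v (hba hv), ha.2.mono <| List.Sublist.map _ <|
    List.monotone_filter_right _ fun p hp => by
      simp only [decide_eq_true_eq] at hp ⊢
      exact fun h => hp (hba h)⟩

variable {cs : CoxeterSystem M W} {L : List (V × B)} {w : W}

lemma mem_wordComplex {J : Finset V} : J ∈ wordComplex cs L w ↔
    (∀ v ∈ J, v ∈ L.map Prod.fst) ∧
      ContainsReduced cs ((L.filter (·.1 ∉ J)).map Prod.snd) w := Iff.rfl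

lemma exists_sublist_of_mem_wordComplex {J : Finset V} (hJ : J ∈ wordComplex cs L w) :
    ∃ L' : List (V × B), L'.Sublist (L.filter (·.1 ∉ J)) ∧
      IsReducedExpression cs (L'.map Prod.snd) w ∧
      J ⊆ (L.map Prod.fst).toFinset \ (L'.map Prod.fst).toFinset := by
  obtain ⟨h1, ω, h2, h3⟩ := hJ
  obtain ⟨L', h4, rfl⟩ := List.sublist_map_iff.mp h2
  refine ⟨L', h4, h3, fun v hv => ?_⟩
  rw [Finset.mem_sdiff, List.mem_toFinset, List.mem_toFinset]
  refine ⟨h1 v hv, fun h => ?_⟩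
  obtain ⟨p, hp, rfl⟩ := List.mem_map.mp h
  have := List.of_mem_filter (h4.subset hp)
  simp only [decide_eq_true_eq] at this
  exact this hv

lemma mem_wordComplex_of_sublist {L' : List (V × B)} (h : L'.Sublist L)
    (hw : IsReducedExpression cs (L'.map Prod.snd) w) :
    (L.map Prod.fst).toFinset \ (L'.map Prod.fst).toFinset ∈ wordComplex cs L w := by
  refine ⟨fun v hv => ?_, L'.map Prod.snd, List.Sublist.map _ ?_, hw⟩
  · rw [Finset.mem_sdiff, List.mem_toFinset] at hv
    exact hv.1
  · have h1 := h.filter (fun p : V × B =>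
      decide (p.1 ∉ (L.map Prod.fst).toFinset \ (L'.map Prod.fst).toFinset))
    rwa [List.filter_eq_self.mpr] at h1
    intro p hp
    simp only [decide_eq_true_eq, Finset.mem_sdiff, not_and, not_not, List.mem_toFinset]
    exact fun _ => List.mem_map_of_mem hp

lemma card_labels_sdiff {L' : List (V × B)} (hnd : (L.map Prod.fst).Nodup) (h : L'.Sublist L)
    (hw : IsReducedExpression cs (L'.map Prod.snd) w) :
    ((L.map Prod.fst).toFinset \ (L'.map Prod.fst).toFinset).card = L.length - cs.length w := by
  have hs := h.map Prod.fst
  rw [Finset.card_sdiff_of_subset, List.toFinset_card_of_nodup hnd,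
    List.toFinset_card_of_nodup (hnd.sublist hs), ← hw.length_eq]
  · simp
  · intro v hv
    rw [List.mem_toFinset] at hv ⊢
    exact hs.subset hv

lemma isFacet_wordComplex_of_sublist {L' : List (V × B)} (hnd : (L.map Prod.fst).Nodup)
    (h : L'.Sublist L) (hw : IsReducedExpression cs (L'.map Prod.snd) w) :
    IsFacet (wordComplex cs L w) ((L.map Prod.fst).toFinset \ (L'.map Prod.fst).toFinset) := by
  refine ⟨mem_wordComplex_of_sublist h hw, fun G hG hFG => ?_⟩
  obtain ⟨L'', h1, h2, h3⟩ := exists_sublist_of_mem_wordComplex hG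
  refine (Finset.eq_of_subset_of_card_le hFG ((Finset.card_le_card h3).trans ?_)).ge
  rw [card_labels_sdiff hnd h hw, card_labels_sdiff hnd (h1.trans List.filter_sublist) h2]

lemma isPure_wordComplex (hnd : (L.map Prod.fst).Nodup) : IsPure (wordComplex cs L w) := by
  have h {F : Finset V} (hF : IsFacet (wordComplex cs L w) F) :
      F.card = L.length - cs.length w := by
    obtain ⟨L', h1, h2, h3⟩ := exists_sublist_of_mem_wordComplex hF.1
    have h4 := h1.trans List.filter_sublist
    rw [hF.eq_of_subset (mem_wordComplex_of_sublist h4 h2) h3, card_labels_sdiff hnd h4 h2]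
  intro F G hF hG
  rw [h hF, h hG]

lemma link_wordComplex {v : V} (hv : v ∈ L.map Prod.fst) :
    link (wordComplex cs L w) {v} = wordComplex cs (L.filter (·.1 ≠ v)) w := by
  ext J
  change J ∈ link (wordComplex cs L w) {v} ↔ J ∈ wordComplex cs (L.filter (·.1 ≠ v)) w
  rw [mem_link_singleton, mem_wordComplex, mem_wordComplex, List.filter_filter]
  have e : (fun p : V × B => decide (p.1 ∉ J) && decide (p.1 ≠ v)) =
      fun p => decide (p.1 ∉ insert v J) := by
    funext p
    rw [← Bool.decide_and, decide_eq_decide, Finset.mem_insert]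
    tauto
  have hm (u : V) : u ∈ (L.filter (·.1 ≠ v)).map Prod.fst ↔ u ∈ L.map Prod.fst ∧ u ≠ v := by
    simp only [List.mem_map, List.mem_filter, decide_eq_true_eq]
    constructor
    · rintro ⟨p, ⟨h1, h2⟩, rfl⟩; exact ⟨⟨p, h1, rfl⟩, h2⟩
    · rintro ⟨⟨p, h1, rfl⟩, h2⟩; exact ⟨p, ⟨h1, h2⟩, rfl⟩
  rw [e]
  simp only [hm]
  constructor
  · rintro ⟨⟨h1, h2⟩, h3⟩
    exact ⟨fun u hu => ⟨h1 u (Finset.mem_insert_of_mem hu), fun h => h3 (h ▸ hu)⟩, h2⟩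
  · rintro ⟨h1, h2⟩
    refine ⟨⟨fun u hu => ?_, h2⟩, fun h => (h1 v h).2 rfl⟩
    rcases Finset.mem_insert.mp hu with rfl | hu
    · exact hv
    · exact (h1 u hu).1

lemma filter_ne_append_singleton {v : V} {i : B} (hv : v ∉ L.map Prod.fst) :
    (L ++ [(v, i)]).filter (·.1 ≠ v) = L := by
  rw [List.filter_append, List.filter_eq_self.mpr]
  · simp
  · intro p hp
    simp only [decide_eq_true_eq]
    rintro rfl
    exact hv (List.mem_map_of_mem hp)

lemma link_wordComplex_append_singleton {v : V} {i : B} (hv : v ∉ L.map Prod.fst) :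
    link (wordComplex cs (L ++ [(v, i)]) w) {v} = wordComplex cs L w := by
  rw [link_wordComplex (by simp), filter_ne_append_singleton hv]

open Classical in
lemma deletion_wordComplex_append_singleton {v : V} {i : B} (hv : v ∉ L.map Prod.fst) :
    deletion (wordComplex cs (L ++ [(v, i)]) w) {v} =
      wordComplex cs L (if cs.IsRightDescent w i then w * cs.simple i else w) := by
  ext J
  change J ∈ deletion (wordComplex cs (L ++ [(v, i)]) w) {v} ↔ J ∈ wordComplex cs L _
  rw [mem_deletion_singleton, mem_wordComplex, mem_wordComplex, ← containsReduced_append_singleton]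
  by_cases hvJ : v ∈ J
  · exact iff_of_false (fun h => h.2 hvJ) fun h => hv (h.1 v hvJ)
  · rw [List.filter_append, List.filter_cons_of_pos (by simpa using hvJ), List.filter_nil,
      List.map_append, List.map_append]
    simp only [List.map_cons, List.map_nil, List.mem_append, List.mem_singleton]
    constructor
    · rintro ⟨⟨h1, h2⟩, -⟩
      exact ⟨fun u hu => (h1 u hu).resolve_right (by rintro rfl; exact hvJ hu), h2⟩
    · rintro ⟨h1, h2⟩
      exact ⟨⟨fun u hu => Or.inl (h1 u hu), h2⟩, hvJ⟩

omit [DecidableEq V] in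
lemma nodup_labels_append_singleton {v : V} {i : B}
    (h : ((L ++ [(v, i)]).map Prod.fst).Nodup) : v ∉ L.map Prod.fst ∧ (L.map Prod.fst).Nodup := by
  rw [List.map_append, List.nodup_append] at h
  refine ⟨fun hv => h.2.2 v hv v (by simp) rfl, h.1⟩

/-- Every subword complex is vertex decomposable: the link and the deletion of the last position
are subword complexes of the word without its last letter. -/
theorem vertexDecomposable_wordComplex (L : List (V × B)) : ∀ w : W, (L.map Prod.fst).Nodup →
    VertexDecomposable (wordComplex cs L w) := by
  classical
  induction L using List.reverseRecOn with
  | nil =>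
    intro w _
    refine VertexDecomposable.simplex _ ?_
    have hJ {J : Finset V} (h : J ∈ wordComplex cs ([] : List (V × B)) w) : J = ∅ :=
      Finset.eq_empty_of_forall_notMem fun v hv => by simpa using h.1 v hv
    by_cases h : ∅ ∈ wordComplex cs ([] : List (V × B)) w
    · refine Or.inr ⟨∅, ?_⟩
      ext J
      refine ⟨fun h => (hJ h).le, fun h' => ?_⟩
      rw [Finset.subset_empty.mp h']
      exact h
    · refine Or.inl (LowerSet.ext (Set.eq_empty_of_forall_notMem fun J h' => ?_))
      exact h (hJ h' ▸ h')
  | append_singleton L p ih =>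
    obtain ⟨v, i⟩ := p
    intro w hnd
    obtain ⟨hv, hL⟩ := nodup_labels_append_singleton hnd
    refine VertexDecomposable.of_deletion_link v (isPure_wordComplex hnd) ?_ ?_
    · rw [deletion_wordComplex_append_singleton hv]; exact ih _ hL
    · rw [link_wordComplex_append_singleton hv]; exact ih _ hL

/-- A subword complex is collapsible unless `w` is the Demazure product of the word. -/
theorem collapsible_wordComplex (L : List (V × B)) : ∀ w : W, (L.map Prod.fst).Nodup →
    ContainsReduced cs (L.map Prod.snd) w → demazureProd cs (L.map Prod.snd) ≠ w →
    Collapsible (wordComplex cs L w) := by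
  classical
  induction L using List.reverseRecOn with
  | nil =>
    rintro w _ ⟨ω, h1, h2, rfl⟩ hne
    rw [List.map_nil, List.sublist_nil] at h1
    subst h1
    simp [demazureProd] at hne
  | append_singleton L p ih =>
    obtain ⟨v, i⟩ := p
    intro w hnd hcon hne
    obtain ⟨hv, hL⟩ := nodup_labels_append_singleton hnd
    have hdel := deletion_wordComplex_append_singleton (cs := cs) (w := w) (i := i) hv
    have hlink := link_wordComplex_append_singleton (cs := cs) (w := w) (i := i) hv
    rw [List.map_append, List.map_cons, List.map_nil] at hcon hne
    rw [demazureProd_append_singleton] at hne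
    rw [containsReduced_append_singleton] at hcon
    set D := demazureProd cs (L.map Prod.snd) with hD
    by_cases hd : cs.IsRightDescent w i
    swap
    · -- the last letter is never used, so its position is a cone point
      rw [if_neg hd] at hcon hdel
      refine Collapsible.cone _ v ?_ fun J hJ => ?_
      · refine (mem_deletion_singleton.mp (?_ : ∅ ∈ deletion _ {v})).1
        rw [hdel]
        exact ⟨by simp, by simpa using hcon⟩
      · by_cases hvJ : v ∈ J
        · rwa [Finset.insert_eq_of_mem hvJ]
        · refine (mem_link_singleton.mp (?_ : J ∈ link _ {v})).1
          rw [hlink, ← hdel]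
          exact mem_deletion_singleton.mpr ⟨hJ, hvJ⟩
    rw [if_pos hd] at hcon hdel
    -- the Demazure product of the shortened word differs from `w * s`
    have hD1 : D ≠ w * cs.simple i := by
      intro h
      rw [if_neg] at hne
      · exact hne (by rw [h]; simp)
      · rw [h]; exact cs.isRightDescent_iff_not_isRightDescent_mul.mp hd
    by_cases hw : ContainsReduced cs (L.map Prod.snd) w
    · have hD2 : D ≠ w := by
        rintro h
        rw [h, if_pos hd] at hne
        exact hne rfl
      refine Collapsible.of_link_deletion (v := v) ?_ ?_
      · rw [hlink]; exact ih w hL hw hD2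
      · rw [hdel]; exact ih _ hL hcon hD1
    · have e : wordComplex cs (L ++ [(v, i)]) w = wordComplex cs L (w * cs.simple i) := by
        rw [← hdel]
        ext J
        change J ∈ wordComplex cs (L ++ [(v, i)]) w ↔ J ∈ deletion _ {v}
        rw [mem_deletion_singleton]
        refine ⟨fun hJ => ⟨hJ, fun hvJ => hw ?_⟩, And.left⟩
        have h1 : J.erase v ∈ link (wordComplex cs (L ++ [(v, i)]) w) {v} :=
          mem_link_singleton.mpr ⟨by rwa [Finset.insert_erase hvJ], Finset.notMem_erase v J⟩
        rw [hlink] at h1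
        exact h1.2.mono (List.filter_sublist.map _)
      rw [e]
      exact ih _ hL hcon hD1

end WordComplex

/-! ### Rotating words, and the stars and costars of subword complexes -/

section Rotation

variable {V B W : Type*} [Group W] {M : CoxeterMatrix B} {cs : CoxeterSystem M W}

/-- Rotating a word for the longest element: `p s r` is a reduced expression for `w` if and only if
`r ρ ψ(p)` is one for `s w₀`, where `ρ` spells `w⁻¹ w₀` and `ψ` is conjugation by `w₀`. -/
lemma isReducedExpression_rotate {w₀ w : W} (h₀ : ∀ u, cs.length u ≤ cs.length w₀) {ψ : B → B}
    (hψ : ∀ ω : List B, cs.wordProd (ω.map ψ) = w₀ * cs.wordProd ω * w₀) {ρ : List B}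
    (hρ : IsReducedExpression cs ρ (w⁻¹ * w₀)) (i : B) (p r : List B) :
    IsReducedExpression cs (r ++ ρ ++ p.map ψ) (cs.simple i * w₀) ↔
      IsReducedExpression cs (p ++ i :: r) w := by
  have hlρ : ρ.length + cs.length w = cs.length w₀ := by
    have := length_mul_longest h₀ w⁻¹
    rw [cs.length_inv] at this
    rw [hρ.length_eq, this]
  have hl : cs.length (cs.simple i * w₀) + 1 = cs.length w₀ := by
    have := length_mul_longest h₀ (cs.simple i)
    rwa [cs.length_simple] at this
  have h1 := longest_mul_longest h₀
  rw [isReducedExpression_iff, isReducedExpression_iff]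
  refine and_congr ?_ ?_
  · rw [cs.wordProd_append, cs.wordProd_append, cs.wordProd_append, cs.wordProd_cons, hψ, hρ.2]
    have e : cs.wordProd r * (w⁻¹ * w₀) * (w₀ * cs.wordProd p * w₀) =
        cs.wordProd r * w⁻¹ * cs.wordProd p * w₀ := by
      calc _ = cs.wordProd r * w⁻¹ * (w₀ * w₀) * cs.wordProd p * w₀ := by group
        _ = _ := by rw [h1, mul_one]
    rw [e, mul_left_inj]
    constructor
    · intro h
      have h2 : w = ((cs.wordProd r)⁻¹ * cs.simple i * (cs.wordProd p)⁻¹)⁻¹ := by rw [← h]; group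
      rw [h2]
      simp [mul_assoc]
    · rintro rfl
      simp [mul_assoc]
  · simp only [List.length_append, List.length_map, List.length_cons]
    omega

/-- If no product of a subword of `P s R` is longer than `w`, then reduced subwords of `R ρ ψ(P)`
for `s w₀` use every letter of `ρ`. -/
lemma eq_of_isReducedExpression_rotate {w₀ w : W} (h₀ : ∀ u, cs.length u ≤ cs.length w₀)
    {ψ : B → B} (hψ : ∀ ω : List B, cs.wordProd (ω.map ψ) = w₀ * cs.wordProd ω * w₀) {ρ : List B}
    (hρ : IsReducedExpression cs ρ (w⁻¹ * w₀)) {i : B} {p r ρ' : List B}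
    (hmax : cs.length (cs.wordProd (p ++ i :: r)) ≤ cs.length w) (hs : ρ'.Sublist ρ)
    (h : IsReducedExpression cs (r ++ ρ' ++ p.map ψ) (cs.simple i * w₀)) : ρ' = ρ := by
  refine hs.eq_of_length_le ?_
  have h1 : cs.wordProd r * cs.wordProd ρ' * (w₀ * cs.wordProd p * w₀) = cs.simple i * w₀ := by
    rw [← h.2, cs.wordProd_append, cs.wordProd_append, hψ]
  have h2 : cs.wordProd r * cs.wordProd ρ' * (w₀ * cs.wordProd p) = cs.simple i := by
    rw [← mul_assoc, mul_left_inj] at h1; exact h1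
  have h3 : cs.wordProd (p ++ i :: r) = w₀ * (cs.wordProd ρ')⁻¹ := by
    rw [cs.wordProd_append, cs.wordProd_cons, ← cs.inv_simple i, ← h2]
    have := longest_inv h₀
    nth_rewrite 2 [← this]
    group
  have h4 := length_longest_mul h₀ (cs.wordProd ρ')⁻¹
  rw [← h3, cs.length_inv] at h4
  have h5 := cs.length_wordProd_le ρ'
  have h6 := length_mul_longest h₀ w⁻¹
  rw [cs.length_inv, ← hρ.length_eq] at h6
  omega

variable [DecidableEq V]

/-- The deletion of any position from a subword complex for the Demazure product is again a
subword complex, up to labels: rotate the word so that the position comes first. -/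
theorem vertexDecomposable_deletion_wordComplex [Finite W] {L : List (V × B)} {w : W}
    (hnd : (L.map Prod.fst).Nodup)
    (hmax : ∀ ω : List B, ω.Sublist (L.map Prod.snd) → cs.length (cs.wordProd ω) ≤ cs.length w)
    {v : V} (hv : v ∈ L.map Prod.fst) :
    VertexDecomposable (deletion (wordComplex cs L w) {v}) := by
  obtain ⟨⟨v, i⟩, hp, rfl⟩ := List.mem_map.mp hv
  obtain ⟨P, R, rfl⟩ := List.append_of_mem hp
  obtain ⟨w₀, h₀⟩ := exists_longest cs
  obtain ⟨ψ, hψ⟩ := exists_conj_longest h₀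
  obtain ⟨ρ, hρ1, hρ2⟩ := cs.exists_isReduced (w⁻¹ * w₀)
  have hρ : IsReducedExpression cs ρ (w⁻¹ * w₀) := ⟨hρ1, hρ2.symm⟩
  -- the letters of `ρ` receive labels of their own
  let ρ' : List ((V ⊕ ℕ) × B) := ((List.range ρ.length).map Sum.inr).zip ρ
  have hρfst : ρ'.map Prod.fst = (List.range ρ.length).map Sum.inr :=
    List.map_fst_zip (by simp)
  have hρsnd : ρ'.map Prod.snd = ρ := List.map_snd_zip (by simp)
  let R' : List ((V ⊕ ℕ) × B) := R.map fun p => (Sum.inl p.1, p.2)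
  let P' : List ((V ⊕ ℕ) × B) := P.map fun p => (Sum.inl p.1, ψ p.2)
  set Γ := wordComplex cs (R' ++ ρ' ++ P') (cs.simple i * w₀) with hΓdef
  have hfst : (R' ++ ρ' ++ P').map Prod.fst = (R.map Prod.fst).map Sum.inl ++
      (List.range ρ.length).map Sum.inr ++ (P.map Prod.fst).map Sum.inl := by
    simp only [List.map_append, hρfst, R', P', List.map_map]
    rfl
  have hnd' : ((R' ++ ρ' ++ P').map Prod.fst).Nodup := by
    rw [hfst]
    simp only [List.map_append, List.map_cons, List.nodup_append', List.nodup_cons,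
      List.disjoint_cons_right] at hnd ⊢
    have hdisj := hnd.2.2.2
    refine ⟨⟨hnd.2.1.2.map Sum.inl_injective, List.nodup_range.map Sum.inr_injective, ?_⟩,
      hnd.1.map Sum.inl_injective, ?_⟩
    · intro x hx hx'
      obtain ⟨u, -, rfl⟩ := List.mem_map.mp hx
      obtain ⟨n, -, h⟩ := List.mem_map.mp hx'
      exact Sum.inr_ne_inl h
    · intro x hx hx'
      obtain ⟨u, hu, rfl⟩ := List.mem_map.mp hx'
      rcases List.mem_append.mp hx with hx | hx
      · obtain ⟨u', hu', h⟩ := List.mem_map.mp hx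
        rw [Sum.inl_injective h] at hu'
        exact hdisj hu hu'
      · obtain ⟨n, -, h⟩ := List.mem_map.mp hx
        exact Sum.inr_ne_inl h
  have hfilt (J : Finset (V ⊕ ℕ)) : ((R' ++ ρ' ++ P').filter (·.1 ∉ J)).map Prod.snd =
      (R.filter (Sum.inl ·.1 ∉ J)).map Prod.snd ++ (ρ'.filter (·.1 ∉ J)).map Prod.snd ++
        ((P.filter (Sum.inl ·.1 ∉ J)).map Prod.snd).map ψ := by
    simp only [List.filter_append, List.map_append, R', P', List.filter_map, List.map_map]
    rfl
  have hsub {J : Finset (V ⊕ ℕ)} (hJ : J ∈ Γ) :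
      (ρ'.filter (·.1 ∉ J)).map Prod.snd = ρ ∧ ContainsReduced cs
        (((P.filter (Sum.inl ·.1 ∉ J)).map Prod.snd) ++ i ::
          (R.filter (Sum.inl ·.1 ∉ J)).map Prod.snd) w := by
    obtain ⟨-, ω, hω, hred⟩ := hJ
    rw [hfilt] at hω
    obtain ⟨ω', p', rfl, hω', hp'⟩ := List.sublist_append_iff.mp hω
    obtain ⟨r, ρ₁, rfl, hr, hρ₁⟩ := List.sublist_append_iff.mp hω'
    obtain ⟨p, hp, rfl⟩ := List.sublist_map_iff.mp hp'
    have hρ₂ : ((ρ'.filter (·.1 ∉ J)).map Prod.snd).Sublist ρ := by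
      conv_rhs => rw [← hρsnd]
      exact List.filter_sublist.map _
    have hlen := hmax (p ++ i :: r) <| by
      rw [List.map_append, List.map_cons]
      exact (hp.trans (List.filter_sublist.map _)).append
        ((hr.trans (List.filter_sublist.map _)).cons_cons _)
    obtain rfl := eq_of_isReducedExpression_rotate h₀ hψ hρ hlen (hρ₁.trans hρ₂) hred
    exact ⟨hρ₂.antisymm hρ₁, p ++ i :: r, hp.append (hr.cons_cons _),
      (isReducedExpression_rotate h₀ hψ hρ i p r).mp hred⟩
  have hlabels (J : Finset V) : (∀ u ∈ J.map ⟨Sum.inl, Sum.inl_injective⟩,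
      u ∈ (R' ++ ρ' ++ P').map Prod.fst) ↔ ∀ u ∈ J, u ∈ R.map Prod.fst ∨ u ∈ P.map Prod.fst := by
    rw [hfst]
    simp
  have hrange : ∀ J ∈ Γ, ∃ I : Finset V, J = I.map ⟨Sum.inl, Sum.inl_injective⟩ := by
    intro J hJ
    refine ⟨J.toLeft, ?_⟩
    ext x
    rcases x with u | n
    · simp
    · simp only [Finset.mem_map, Finset.mem_toLeft, Function.Embedding.coeFn_mk, reduceCtorEq,
        and_false, exists_false, iff_false]
      intro hn
      have h1 := congrArg List.length (hsub hJ).1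
      have h2 : ρ'.length = ρ.length := by rw [← hρsnd, List.length_map]
      rw [List.length_map, ← h2, List.length_filter_eq_length_iff] at h1
      have h3 := hJ.1 _ hn
      rw [hfst, List.append_assoc, List.mem_append, List.mem_append, ← hρfst] at h3
      simp only [List.mem_map, reduceCtorEq, and_false, exists_false, or_false, false_or] at h3
      obtain ⟨q, hq, hqn⟩ := h3
      have h4 := h1 q hq
      rw [decide_eq_true_eq, hqn] at h4
      exact h4 hn
  convert (vertexDecomposable_wordComplex (cs := cs) _ (cs.simple i * w₀) hnd').relabel _ hrange
  ext J
  change J ∈ deletion _ {v} ↔ J.map _ ∈ Γ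
  rw [mem_deletion_singleton, mem_wordComplex]
  have hP : (P.filter fun p => (Sum.inl p.1 : V ⊕ ℕ) ∉ J.map ⟨Sum.inl, Sum.inl_injective⟩) =
      P.filter (·.1 ∉ J) := by simp
  have hR : (R.filter fun p => (Sum.inl p.1 : V ⊕ ℕ) ∉ J.map ⟨Sum.inl, Sum.inl_injective⟩) =
      R.filter (·.1 ∉ J) := by simp
  have hL (hvJ : v ∉ J) : ((P ++ (v, i) :: R).filter (·.1 ∉ J)).map Prod.snd =
      (P.filter (·.1 ∉ J)).map Prod.snd ++ i :: (R.filter (·.1 ∉ J)).map Prod.snd := by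
    rw [List.filter_append, List.filter_cons_of_pos (by simpa using hvJ), List.map_append,
      List.map_cons]
  constructor
  · rintro ⟨⟨h1, h2⟩, hvJ⟩
    refine ⟨(hlabels J).mpr fun u hu => ?_, ?_⟩
    · have h3 := h1 u hu
      rw [List.map_append, List.map_cons, List.mem_append, List.mem_cons] at h3
      rcases h3 with h3 | h3 | h3
      · exact Or.inr h3
      · exact absurd hu (h3 ▸ hvJ)
      · exact Or.inl h3
    · rw [hL hvJ] at h2
      obtain ⟨p, r, hp, hr, hred⟩ := h2.exists_through fun ω hω => hmax ω <| by
        refine hω.trans ?_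
        rw [List.map_append, List.map_cons]
        exact (List.filter_sublist.map _).append ((List.filter_sublist.map _).cons_cons _)
      rw [hfilt, hP, hR]
      refine ⟨r ++ ρ ++ p.map ψ, (hr.append ?_).append (hp.map ψ),
        (isReducedExpression_rotate h₀ hψ hρ i p r).mpr hred⟩
      rw [List.filter_eq_self.mpr, hρsnd]
      intro q hq
      have h3 : q.1 ∈ ρ'.map Prod.fst := List.mem_map_of_mem hq
      rw [hρfst] at h3
      obtain ⟨n, -, hn⟩ := List.mem_map.mp h3
      rw [← hn]
      simp
  · intro hJ
    have hJ' := (hlabels J).mp hJ.1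
    have hvJ : v ∉ J := by
      intro hvJ
      simp only [List.map_append, List.map_cons, List.nodup_append', List.nodup_cons,
        List.disjoint_cons_right] at hnd
      rcases hJ' v hvJ with h | h
      · exact hnd.2.1.1 h
      · exact hnd.2.2.1 h
    refine ⟨⟨fun u hu => ?_, ?_⟩, hvJ⟩
    · rw [List.map_append, List.map_cons, List.mem_append, List.mem_cons]
      rcases hJ' u hu with h | h
      · exact Or.inr (Or.inr h)
      · exact Or.inl h
    · rw [hL hvJ, ← hP, ← hR]
      exact (hsub hJ).2

/-- In a subword complex for the Demazure product, no vertex lies in all facets above a face that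
does not contain it. -/
lemma exists_isFacet_wordComplex_notMem {L : List (V × B)} {w : W} (hnd : (L.map Prod.fst).Nodup)
    (hmax : ∀ ω : List B, ω.Sublist (L.map Prod.snd) → cs.length (cs.wordProd ω) ≤ cs.length w)
    {v : V} (hv : v ∈ L.map Prod.fst) {J : Finset V} (hJ : J ∈ wordComplex cs L w) (hvJ : v ∉ J) :
    ∃ F, IsFacet (wordComplex cs L w) F ∧ J ⊆ F ∧ v ∉ F := by
  obtain ⟨⟨v, i⟩, hp, rfl⟩ := List.mem_map.mp hv
  obtain ⟨P, R, rfl⟩ := List.append_of_mem hp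
  have hL : (P ++ (v, i) :: R).filter (·.1 ∉ J) =
      P.filter (·.1 ∉ J) ++ (v, i) :: R.filter (·.1 ∉ J) := by
    rw [List.filter_append, List.filter_cons_of_pos (by simpa using hvJ)]
  have h2 := hJ.2
  rw [hL, List.map_append, List.map_cons] at h2
  obtain ⟨p, r, hp, hr, hred⟩ := h2.exists_through fun ω hω => hmax ω <| by
    refine hω.trans ?_
    rw [List.map_append, List.map_cons]
    exact (List.filter_sublist.map _).append ((List.filter_sublist.map _).cons_cons _)
  obtain ⟨p, hp', rfl⟩ := List.sublist_map_iff.mp hp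
  obtain ⟨r, hr', rfl⟩ := List.sublist_map_iff.mp hr
  have hsub : (p ++ (v, i) :: r).Sublist ((P ++ (v, i) :: R).filter (·.1 ∉ J)) := by
    rw [hL]; exact hp'.append (hr'.cons_cons _)
  refine ⟨_, isFacet_wordComplex_of_sublist hnd (hsub.trans List.filter_sublist)
    (by simpa using hred), fun u hu => ?_, by simp⟩
  rw [Finset.mem_sdiff, List.mem_toFinset, List.mem_toFinset]
  refine ⟨hJ.1 u hu, fun h => ?_⟩
  obtain ⟨q, hq, rfl⟩ := List.mem_map.mp h
  have := List.of_mem_filter (hsub.subset hq)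
  rw [decide_eq_true_eq] at this
  exact this hu

/-- For `v ∈ I`, the link and the deletion of `v` in the star of `I` both equal the star of
`I.erase v` in the link of `v`. -/
theorem vertexDecomposable_star_wordComplex {L : List (V × B)} {w : W} {I : Finset V}
    (hnd : (L.map Prod.fst).Nodup) (hIL : I ∈ wordComplex cs L w) :
    VertexDecomposable (star (wordComplex cs L w) I) := by
  induction hI : I.card generalizing L I with
  | zero =>
    rw [Finset.card_eq_zero] at hI
    convert vertexDecomposable_wordComplex (cs := cs) L w hnd
    ext J
    change J ∈ star _ I ↔ J ∈ wordComplex cs L w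
    rw [mem_star, hI, Finset.empty_union]
  | succ n ih =>
    obtain ⟨v, hv⟩ : I.Nonempty := Finset.card_pos.mp (by omega)
    have hlink := link_wordComplex (cs := cs) (w := w) (hIL.1 v hv)
    have hIL' : I.erase v ∈ link (wordComplex cs L w) {v} :=
      mem_link_singleton.mpr ⟨by rwa [Finset.insert_erase hv], Finset.notMem_erase v I⟩
    rw [hlink] at hIL'
    have key := ih (hnd.sublist (List.filter_sublist.map _)) hIL'
      (by rw [Finset.card_erase_of_mem hv, hI]; rfl)
    refine VertexDecomposable.of_deletion_link v ((isPure_wordComplex hnd).star I) ?_ ?_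
    · rwa [deletion_star_singleton hv, hlink]
    · rwa [link_star_singleton hv, hlink]

/-- For `v ∈ I`, the deletion of `v` in the costar of `I` is its deletion in the whole complex, and
its link there is the costar of `I.erase v` in the link of `v`. -/
theorem vertexDecomposable_costar_wordComplex [Finite W] {L : List (V × B)} {w : W} {I : Finset V}
    (hnd : (L.map Prod.fst).Nodup)
    (hmax : ∀ ω : List B, ω.Sublist (L.map Prod.snd) → cs.length (cs.wordProd ω) ≤ cs.length w)
    (hIL : I ∈ wordComplex cs L w) : VertexDecomposable (costar (wordComplex cs L w) I) := by
  induction hI : I.card generalizing L I with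
  | zero =>
    rw [Finset.card_eq_zero] at hI
    refine VertexDecomposable.simplex _ (Or.inl ?_)
    refine LowerSet.ext (Set.eq_empty_of_forall_notMem fun J => ?_)
    rintro ⟨F, -, -, h⟩
    exact h (hI ▸ Finset.empty_subset F)
  | succ n ih =>
    obtain ⟨v, hv⟩ : I.Nonempty := Finset.card_pos.mp (by omega)
    have hvL := hIL.1 v hv
    have hlink := link_wordComplex (cs := cs) (w := w) hvL
    have hIL' : I.erase v ∈ link (wordComplex cs L w) {v} :=
      mem_link_singleton.mpr ⟨by rwa [Finset.insert_erase hv], Finset.notMem_erase v I⟩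
    rw [hlink] at hIL'
    refine VertexDecomposable.of_deletion_link v ((isPure_wordComplex hnd).costar I) ?_ ?_
    · rw [deletion_costar_singleton hv fun J hJ hvJ =>
        exists_isFacet_wordComplex_notMem hnd hmax hvL hJ hvJ]
      exact vertexDecomposable_deletion_wordComplex hnd hmax hvL
    · rw [link_costar_singleton hv, hlink]
      exact ih (hnd.sublist (List.filter_sublist.map _))
        (fun ω hω => hmax ω (hω.trans (List.filter_sublist.map _))) hIL'
        (by rw [Finset.card_erase_of_mem hv, hI]; rfl)

lemma filter_mem_eq_of_sublist {α : Type*} [DecidableEq α] {l m : List α} (hm : m.Nodup)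
    (h : l.Sublist m) : m.filter (· ∈ l) = l := by
  have h1 : l.Sublist (m.filter (· ∈ l)) := by
    have := h.filter (· ∈ l)
    rwa [List.filter_eq_self.mpr (by simp)] at this
  refine (h1.eq_of_length_le ((hm.filter _).subperm ?_).length_le).symm
  intro a ha
  simpa using List.of_mem_filter ha

/-- The subword complex on positions is the labelled one whose labels are the positions. -/
lemma subwordComplex_eq_wordComplex (Q : List B) (w : W) : subwordComplex cs Q w =
    wordComplex cs ((List.finRange Q.length).map fun i => (i, Q.get i)) w := by
  ext J
  change J ∈ subwordComplex cs Q w ↔ J ∈ wordComplex cs _ w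
  have h2 (J : Finset (Fin Q.length)) :
      (((List.finRange Q.length).map fun i => (i, Q.get i)).filter (·.1 ∉ J)).map Prod.snd =
        subword Q Jᶜ := by
    simp only [List.filter_map, List.map_map, subword, Finset.mem_compl]
    rfl
  rw [mem_wordComplex, h2]
  have h1 : ∀ v ∈ J, v ∈ ((List.finRange Q.length).map fun i => (i, Q.get i)).map Prod.fst := by
    intro v _
    simp
  rw [and_iff_right h1]
  constructor
  · rintro ⟨I, hJI, hI⟩
    refine ⟨subword Q Iᶜ, List.Sublist.map _ (List.monotone_filter_right _ fun i hi => ?_), hI⟩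
    simp only [Finset.mem_compl, decide_eq_true_eq] at hi ⊢
    exact fun h => hi (hJI h)
  · rintro ⟨ω, hω, hred⟩
    obtain ⟨l, hl, rfl⟩ := List.sublist_map_iff.mp hω
    refine ⟨l.toFinsetᶜ, ?_, ?_⟩
    · intro i hi
      rw [Finset.mem_compl, List.mem_toFinset]
      intro h
      have := List.of_mem_filter (hl.subset h)
      simp only [Finset.mem_compl, decide_eq_true_eq] at this
      exact this hi
    · rw [compl_compl, subword]
      convert hred
      have h3 := hl.trans List.filter_sublist
      simp only [List.mem_toFinset]
      exact filter_mem_eq_of_sublist (List.nodup_finRange _) h3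

end Rotation

/-! ### Realizations of collapsible complexes -/

section Realization

/-- A set that can be pushed along straight segments inside itself into a contractible subset is
contractible. -/
lemma contractibleSpace_of_segment {E : Type*} [AddCommGroup E] [Module ℝ E] [TopologicalSpace E]
    [ContinuousAdd E] [ContinuousSMul ℝ E] {S T : Set E} (hTS : T ⊆ S) {f : E → E}
    (hf : Continuous f) (hfT : ∀ p ∈ S, f p ∈ T)
    (hseg : ∀ p ∈ S, ∀ t : ℝ, 0 ≤ t → t ≤ 1 → (1 - t) • p + t • f p ∈ S)
    (hT : ContractibleSpace T) : ContractibleSpace S := by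
  rw [contractible_iff_id_nullhomotopic]
  let r : C(S, T) := ⟨fun p => ⟨f p, hfT p p.2⟩, by fun_prop⟩
  let ι : C(T, S) := ⟨Set.inclusion hTS, continuous_inclusion hTS⟩
  have h1 : (ι.comp ((ContinuousMap.id T).comp r)).Nullhomotopic :=
    ((id_nullhomotopic T).comp_left r).comp_right ι
  obtain ⟨y, hy⟩ := h1
  refine ⟨y, ContinuousMap.Homotopic.trans ⟨⟨⟨fun q =>
    ⟨(1 - (q.1 : ℝ)) • (q.2 : E) + (q.1 : ℝ) • f q.2, hseg q.2 q.2.2 _ q.1.2.1 q.1.2.2⟩, ?_⟩, ?_, ?_⟩⟩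
    hy⟩
  · fun_prop
  · intro p; simp
  · intro p
    ext1
    simp [ι, r]

variable {V : Type*} [DecidableEq V]

/-- The map underlying a collapse: as much mass as possible is moved from the vertices of `σ`, in
equal amounts, to the vertex `x`. -/
noncomputable def pushMap (σ : Finset V) (hσ : σ.Nonempty) (x : V) (p : V → ℝ) : V → ℝ := fun i =>
  p i + (σ.inf' hσ p) * ((if i = x then (σ.card : ℝ) else 0) - if i ∈ σ then 1 else 0)

lemma continuous_pushMap (σ : Finset V) (hσ : σ.Nonempty) (x : V) :
    Continuous (pushMap σ hσ x) := by
  refine continuous_pi fun i => ?_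
  have : Continuous fun p : V → ℝ => σ.inf' hσ p :=
    Continuous.finset_inf'_apply hσ fun i _ => continuous_apply i
  unfold pushMap
  fun_prop

variable [Fintype V]

/-- The geometric realization in barycentric coordinates. -/
lemma mem_realization {Δ : Complex V} {p : V → ℝ} : p ∈ realization Δ ↔
    (∀ i, 0 ≤ p i) ∧ ∑ i, p i = 1 ∧ ∃ J ∈ Δ, ∀ i ∉ J, p i = 0 := by
  simp only [realization, Set.mem_iUnion]
  constructor
  · rintro ⟨J, hJ, hp⟩
    have hsub : convexHull ℝ ((fun i : V => (Pi.single i 1 : V → ℝ)) '' (J : Set V)) ⊆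
        {p | (∀ i, 0 ≤ p i) ∧ ∑ i, p i = 1 ∧ ∀ i ∉ J, p i = 0} := by
      refine convexHull_min ?_ ?_
      · rintro _ ⟨i, hi, rfl⟩
        refine ⟨fun j => ?_, by simp, fun j hj => ?_⟩
        · by_cases h : j = i
          · subst h; simp
          · simp [h]
        · have : j ≠ i := by rintro rfl; exact hj hi
          simp [this]
      · rintro p ⟨hp1, hp2, hp3⟩ q ⟨hq1, hq2, hq3⟩ a b ha hb hab
        refine ⟨fun i => ?_, ?_, fun i hi => ?_⟩
        · have := mul_nonneg ha (hp1 i)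
          have := mul_nonneg hb (hq1 i)
          simp; linarith
        · simp [Finset.sum_add_distrib, ← Finset.mul_sum, hp2, hq2, hab]
        · simp [hp3 i hi, hq3 i hi]
    obtain ⟨h1, h2, h3⟩ := hsub hp
    exact ⟨h1, h2, J, hJ, h3⟩
  · rintro ⟨h1, h2, J, hJ, h3⟩
    refine ⟨J, hJ, ?_⟩
    have hsum : ∑ i ∈ J, p i = 1 := by
      rw [← h2]
      exact Finset.sum_subset (Finset.subset_univ J) fun i _ hi => h3 i hi
    have hp : p = ∑ i ∈ J, p i • (Pi.single i 1 : V → ℝ) := by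
      ext j
      simp only [Finset.sum_apply, Pi.smul_apply, Pi.single_apply, smul_eq_mul, mul_ite, mul_one,
        mul_zero, Finset.sum_ite_eq]
      split_ifs with h
      · rfl
      · exact h3 j h
    rw [hp]
    exact (convex_convexHull ℝ _).sum_mem (fun i _ => h1 i) hsum fun i hi =>
      subset_convexHull ℝ _ ⟨i, hi, rfl⟩

lemma contractibleSpace_realization_of_cone {Δ : Complex V} {x : V} (hne : ∅ ∈ Δ)
    (hx : ∀ J ∈ Δ, insert x J ∈ Δ) : ContractibleSpace (realization Δ) := by
  have hmem : (Pi.single x 1 : V → ℝ) ∈ realization Δ := by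
    refine mem_realization.mpr ⟨fun j => ?_, by simp, _, hx _ hne, fun i hi => ?_⟩
    · by_cases h : j = x
      · subst h; simp
      · simp [h]
    · have : i ≠ x := by rintro rfl; exact hi (Finset.mem_insert_self _ _)
      simp [this]
  refine StarConvex.contractibleSpace (x := (Pi.single x 1 : V → ℝ)) ?_ ⟨_, hmem⟩
  intro p hp a b ha hb hab
  obtain ⟨h1, h2, J, hJ, h3⟩ := mem_realization.mp hp
  obtain ⟨h1', h2', -⟩ := mem_realization.mp hmem
  refine mem_realization.mpr ⟨fun i => ?_, ?_, _, hx J hJ, fun i hi => ?_⟩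
  · have := mul_nonneg ha (h1' i)
    have := mul_nonneg hb (h1 i)
    simp only [Pi.add_apply, Pi.smul_apply, smul_eq_mul]; linarith
  · simp only [Pi.add_apply, Pi.smul_apply, smul_eq_mul, Finset.sum_add_distrib, ← Finset.mul_sum,
      h2, h2', mul_one, hab]
  · rw [Finset.mem_insert, not_or] at hi
    simp [h3 i hi.2, hi.1]

lemma sum_pushMap (σ : Finset V) (hσ : σ.Nonempty) (x : V) (p : V → ℝ) :
    ∑ i, pushMap σ hσ x p i = ∑ i, p i := by
  simp [pushMap, Finset.sum_add_distrib, ← Finset.mul_sum, Finset.sum_sub_distrib]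

/-- A collapse does not change whether the realization is contractible. -/
lemma contractibleSpace_realization_of_collapse {Δ : Complex V} {σ : Finset V} {x : V}
    (hσ : σ.Nonempty) (hxσ : x ∉ σ) (hx : ∀ J ∈ Δ, σ ⊆ J → insert x J ∈ Δ)
    (hdel : ContractibleSpace (realization (deletion Δ σ))) :
    ContractibleSpace (realization Δ) := by
  have hpos {p : V → ℝ} (hp : ∀ i, 0 ≤ p i) (i) : 0 ≤ pushMap σ hσ x p i := by
    have hm : 0 ≤ σ.inf' hσ p := Finset.le_inf' _ _ fun i _ => hp i
    unfold pushMap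
    by_cases hi : i ∈ σ
    · have hix : i ≠ x := by rintro rfl; exact hxσ hi
      have := Finset.inf'_le p hi
      simp only [hi, hix, if_true, if_false]
      linarith
    · have := hp i
      simp only [hi, if_false, sub_zero]
      split_ifs <;> positivity
  -- the push is trivial off the star of `σ`, and stays in the cone with apex `x` inside it
  have hsupp {p : V → ℝ} (hp : p ∈ realization Δ) : ∃ K ∈ Δ, (∀ i ∉ K, p i = 0) ∧
      ∀ i ∉ K, pushMap σ hσ x p i = 0 := by
    obtain ⟨h1, h2, J, hJ, h3⟩ := mem_realization.mp hp
    by_cases hσJ : σ ⊆ J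
    · refine ⟨_, hx J hJ hσJ, fun i hi => ?_, fun i hi => ?_⟩ <;>
        rw [Finset.mem_insert, not_or] at hi
      · exact h3 i hi.2
      · have : i ∉ σ := fun h => hi.2 (hσJ h)
        simp [pushMap, h3 i hi.2, hi.1, this]
    · refine ⟨J, hJ, h3, fun i hi => ?_⟩
      obtain ⟨j, hj, hjJ⟩ := Finset.not_subset.mp hσJ
      have hm : σ.inf' hσ p = 0 := le_antisymm ((Finset.inf'_le p hj).trans (h3 j hjJ).le)
        (Finset.le_inf' _ _ fun i _ => h1 i)
      simp [pushMap, hm, h3 i hi]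
  refine contractibleSpace_of_segment (T := realization (deletion Δ σ)) (f := pushMap σ hσ x) ?_
    (continuous_pushMap σ hσ x) ?_ ?_ hdel
  · intro p hp
    obtain ⟨h1, h2, J, hJ, h3⟩ := mem_realization.mp hp
    exact mem_realization.mpr ⟨h1, h2, J, hJ.1, h3⟩
  · intro p hp
    obtain ⟨h1, h2, -⟩ := mem_realization.mp hp
    obtain ⟨K, hK, -, h4⟩ := hsupp hp
    obtain ⟨j, hj, hjmin⟩ := Finset.exists_mem_eq_inf' hσ p
    have hjx : j ≠ x := by rintro rfl; exact hxσ hj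
    refine mem_realization.mpr ⟨hpos h1, by rw [sum_pushMap, h2], K.erase j,
      ⟨Δ.lower (Finset.erase_subset j K) hK, fun h => Finset.notMem_erase j K (h hj)⟩,
      fun i hi => ?_⟩
    by_cases hij : i = j
    · subst hij
      simp [pushMap, hj, hjx, hjmin]
    · exact h4 i fun h => hi (Finset.mem_erase.mpr ⟨hij, h⟩)
  · intro p hp t ht0 ht1
    obtain ⟨h1, h2, -⟩ := mem_realization.mp hp
    obtain ⟨K, hK, h3, h4⟩ := hsupp hp
    refine mem_realization.mpr ⟨fun i => ?_, ?_, K, hK, fun i hi => ?_⟩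
    · have := mul_nonneg (sub_nonneg.mpr ht1) (h1 i)
      have := mul_nonneg ht0 (hpos h1 i)
      simp only [Pi.add_apply, Pi.smul_apply, smul_eq_mul]; linarith
    · simp only [Pi.add_apply, Pi.smul_apply, smul_eq_mul, Finset.sum_add_distrib,
        ← Finset.mul_sum, sum_pushMap, h2]
      ring
    · simp [h3 i hi, h4 i hi]

theorem Collapsible.contractibleSpace_realization {Δ : Complex V} (h : Collapsible Δ) :
    ContractibleSpace (realization Δ) := by
  induction h with
  | cone Δ x hne hx => exact contractibleSpace_realization_of_cone hne hx
  | collapse Δ σ x hσ hxσ hx _ ih => exact contractibleSpace_realization_of_collapse hσ hxσ hx ih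

end Realization

/-! ### Spheres are not contractible -/

section Sphere

open MeasureTheory Metric Set
open scoped Topology NNReal

variable {E : Type*} [NormedAddCommGroup E] [InnerProductSpace ℝ E]

/-- A map that vanishes outside a ball is Lipschitz as soon as it is so on the ball: between a point
inside and a point outside, the segment meets the sphere. -/
lemma lipschitzWith_of_eq_zero_outside {g : E → E} {r : ℝ} {K : ℝ≥0}
    (hg : LipschitzOnWith K g (closedBall 0 r)) (h0 : ∀ x, r ≤ ‖x‖ → g x = 0) :
    LipschitzWith K g := by
  have key {x y : E} (hx : ‖x‖ ≤ r) (hy : r ≤ ‖y‖) : dist (g x) (g y) ≤ K * dist x y := by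
    obtain ⟨z, hz, hzr⟩ : ∃ z ∈ segment ℝ x y, ‖z‖ = r := by
      have hc : ContinuousOn (fun z : E => ‖z‖) (segment ℝ x y) := continuous_norm.continuousOn
      exact (convex_segment x y).isPreconnected.intermediate_value
        (left_mem_segment ℝ x y) (right_mem_segment ℝ x y) hc ⟨hx, hy⟩
    rw [h0 y hy, ← h0 z hzr.ge]
    refine (hg.dist_le_mul x (by simpa using hx) z (by simpa using hzr.le)).trans ?_
    have := dist_add_dist_of_mem_segment hz
    have := dist_nonneg (x := z) (y := y)
    gcongr
    linarith
  refine LipschitzWith.of_dist_le_mul fun x y => ?_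
  rcases le_total ‖x‖ r with hx | hx <;> rcases le_total ‖y‖ r with hy | hy
  · exact hg.dist_le_mul x (by simpa using hx) y (by simpa using hy)
  · exact key hx hy
  · rw [dist_comm, dist_comm x y]; exact key hy hx
  · rw [h0 x hx, h0 y hy, dist_self]; positivity

variable [FiniteDimensional ℝ E]

/-- The determinant of `id + t A` is a polynomial in `t`, so its value at `1` is a fixed
combination of its values at sufficiently many nodes. -/
lemma exists_det_interpolation (s : Finset ℝ) (hs : Module.finrank ℝ E < s.card) :
    ∃ c : ℝ → ℝ, ∑ t ∈ s, c t = 1 ∧ ∀ A : E →L[ℝ] E,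
      (ContinuousLinearMap.id ℝ E + A).det =
        ∑ t ∈ s, c t * (ContinuousLinearMap.id ℝ E + t • A).det := by
  classical
  have hinj : Set.InjOn (id : ℝ → ℝ) s := Function.injective_id.injOn
  refine ⟨fun t => (Lagrange.basis s id t).eval 1, ?_, fun A => ?_⟩
  · rw [← Polynomial.eval_finsetSum, Lagrange.sum_basis hinj (Finset.card_pos.mp (by omega)),
      Polynomial.eval_one]
  · let b := Module.finBasis ℝ E
    let N := LinearMap.toMatrix b b (A : E →ₗ[ℝ] E)
    let P : Polynomial ℝ := Matrix.det ((Polynomial.X : Polynomial ℝ) • N.map Polynomial.C +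
      (1 : Matrix (Fin (Module.finrank ℝ E)) (Fin (Module.finrank ℝ E)) ℝ).map Polynomial.C)
    have hdeg : P.degree < s.card := by
      refine lt_of_le_of_lt (Polynomial.degree_le_natDegree) ?_
      have := Polynomial.natDegree_det_X_add_C_le N 1
      rw [Fintype.card_fin] at this
      exact_mod_cast this.trans_lt hs
    have heval (t : ℝ) : P.eval t = (ContinuousLinearMap.id ℝ E + t • A).det := by
      rw [ContinuousLinearMap.det, ← LinearMap.det_toMatrix b, ← Polynomial.coe_evalRingHom,
        RingHom.map_det]
      congr 1
      ext i j
      simp [N, LinearMap.toMatrix_apply, Matrix.one_apply, Finsupp.single_apply, eq_comm, add_comm]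
      split_ifs <;> simp [mul_comm]
    have h1 := Lagrange.eq_interpolate (f := P) hinj hdeg
    have h2 := congrArg (Polynomial.eval 1) h1
    rw [Lagrange.interpolate_apply, Polynomial.eval_finsetSum, heval, one_smul] at h2
    rw [h2]
    refine Finset.sum_congr rfl fun t _ => ?_
    rw [Polynomial.eval_mul, Polynomial.eval_C, ← heval, mul_comm]
    rfl

/-- The determinant does not vanish on the segment from `id` to `id + A`. -/
lemma det_id_add_pos {A : E →L[ℝ] E} (hA : ‖A‖ < 1) :
    0 < (ContinuousLinearMap.id ℝ E + A).det := by
  have hne (s : ℝ) (hs : s ∈ Icc (0 : ℝ) 1) : (ContinuousLinearMap.id ℝ E + s • A).det ≠ 0 := by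
    intro h
    obtain ⟨v, hv, hv0⟩ := (Submodule.ne_bot_iff _).mp (LinearMap.bot_lt_ker_of_det_eq_zero h).ne'
    have h1 : v + s • A v = 0 := hv
    have h2 : ‖v‖ = ‖s • A v‖ := by
      rw [← norm_neg (s • A v), ← eq_neg_of_add_eq_zero_left h1]
    have h3 : ‖s • A v‖ ≤ 1 * (‖A‖ * ‖v‖) := by
      rw [norm_smul]
      refine mul_le_mul ?_ (A.le_opNorm v) (norm_nonneg _) zero_le_one
      rw [Real.norm_eq_abs, abs_of_nonneg hs.1]; exact hs.2
    have h4 : 0 < ‖v‖ := norm_pos_iff.mpr hv0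
    nlinarith
  by_contra hneg
  have hcont : ContinuousOn (fun s : ℝ => (ContinuousLinearMap.id ℝ E + s • A).det) (Icc 0 1) := by
    refine Continuous.continuousOn ?_
    exact ContinuousLinearMap.continuous_det.comp (by fun_prop)
  have h0 : (ContinuousLinearMap.id ℝ E + (0 : ℝ) • A).det = 1 := by
    simp [ContinuousLinearMap.det]
  obtain ⟨s, hs, hs0⟩ := intermediate_value_Icc' zero_le_one hcont
    (show (0 : ℝ) ∈ Icc _ _ from ⟨by simpa using not_lt.mp hneg, by rw [h0]; exact zero_le_one⟩)
  exact hne s hs hs0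

/-- A small multiple of a Lipschitz displacement that vanishes outside a ball permutes the ball. -/
lemma image_closedBall_eq {g : E → E} {r t : ℝ} {K : ℝ≥0} (hg : LipschitzWith K g)
    (h0 : ∀ x, r ≤ ‖x‖ → g x = 0) (hmaps : ∀ x, ‖x‖ ≤ r → ‖x + g x‖ ≤ r)
    (ht0 : 0 ≤ t) (ht1 : t ≤ 1) (htK : t * K < 1) :
    Function.Injective (fun x => x + t • g x) ∧
      (fun x => x + t • g x) '' closedBall 0 r = closedBall 0 r := by
  lift t to ℝ≥0 using ht0
  have happrox : ApproximatesLinearOn (fun x => x + (t : ℝ) • g x)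
      ((ContinuousLinearEquiv.refl ℝ E : E ≃L[ℝ] E) : E →L[ℝ] E) univ (t * K) := by
    intro x _ y _
    have h1 := hg.dist_le_mul x y
    have e : x + (t : ℝ) • g x - (y + (t : ℝ) • g y) - (x - y) = (t : ℝ) • (g x - g y) := by module
    rw [dist_eq_norm, dist_eq_norm] at h1
    simp only [ContinuousLinearEquiv.coe_refl, ContinuousLinearMap.coe_id', id_eq, e, norm_smul,
      NNReal.coe_mul, Real.norm_eq_abs, NNReal.abs_eq, mul_assoc]
    gcongr
  have hc : Subsingleton E ∨ t * K <
      ‖((ContinuousLinearEquiv.refl ℝ E).symm : E →L[ℝ] E)‖₊⁻¹ := by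
    rcases subsingleton_or_nontrivial E with h | h
    · exact Or.inl h
    · right
      have : ‖((ContinuousLinearEquiv.refl ℝ E).symm : E →L[ℝ] E)‖₊ = 1 := by
        simp
      rw [this, inv_one]
      exact_mod_cast htK
  refine ⟨injOn_univ.mp (happrox.injOn hc), Subset.antisymm ?_ fun y hy => ?_⟩
  · rintro _ ⟨x, hx, rfl⟩
    rw [mem_closedBall_zero_iff] at hx ⊢
    have e : x + (t : ℝ) • g x = (1 - (t : ℝ)) • x + (t : ℝ) • (x + g x) := by module
    simp only
    rw [e]
    refine (norm_add_le _ _).trans ?_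
    rw [norm_smul, norm_smul, Real.norm_eq_abs, Real.norm_eq_abs, NNReal.abs_eq,
      abs_of_nonneg (sub_nonneg.mpr ht1)]
    nlinarith [hmaps x hx, t.coe_nonneg]
  · obtain ⟨x, rfl⟩ := happrox.surjective hc y
    refine ⟨x, ?_, rfl⟩
    by_contra hx
    rw [mem_closedBall_zero_iff, not_le] at hx
    simp only [h0 x hx.le, smul_zero, add_zero, mem_closedBall_zero_iff] at hy
    linarith

/-- There is no `C¹` retraction of a closed ball onto its boundary sphere: the volume of the ball
is `∫ det (id + t G')` for small `t ≥ 0`, hence, both sides being polynomial in `t`, also for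
`t = 1`; but `id + G` has singular derivative everywhere, as its values lie on a sphere. -/
theorem not_contDiff_retraction {G : E → E} {r : ℝ} (hr : 0 < r) (hG : ContDiff ℝ 1 G)
    (h0 : ∀ x, ‖x‖ = r → G x = 0) (hnorm : ∀ x, ‖x + G x‖ = r) : False := by
  borelize E
  let μ : Measure E := Measure.addHaar
  have hderiv (x : E) : HasFDerivAt G (fderiv ℝ G x) x :=
    (hG.differentiable one_ne_zero x).hasFDerivAt
  have hcont : Continuous (fderiv ℝ G) := hG.continuous_fderiv one_ne_zero
  have hcompact : IsCompact (closedBall (0 : E) r) := isCompact_closedBall 0 r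
  -- a bound for the derivative on the ball, which is also a Lipschitz constant for `G`
  obtain ⟨K, hK⟩ : ∃ K : ℝ≥0, ∀ x ∈ closedBall (0 : E) r, ‖fderiv ℝ G x‖ ≤ K := by
    obtain ⟨C, hC⟩ := hcompact.exists_bound_of_continuousOn hcont.continuousOn
    exact ⟨C.toNNReal, fun x hx => (hC x hx).trans (Real.le_coe_toNNReal C)⟩
  have hLip : LipschitzOnWith K G (closedBall 0 r) :=
    (convex_closedBall (0 : E) r).lipschitzOnWith_of_nnnorm_hasFDerivWithin_le
      (fun x _ => (hderiv x).hasFDerivWithinAt) fun x hx => hK x hx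
  -- the displacement `G`, cut off outside the ball
  classical
  let g : E → E := fun x => if ‖x‖ ≤ r then G x else 0
  have hgG {x : E} (hx : ‖x‖ ≤ r) : g x = G x := if_pos hx
  have hg0 (x : E) (hx : r ≤ ‖x‖) : g x = 0 := by
    rcases hx.eq_or_lt with h | h
    · rw [hgG h.ge, h0 x h.symm]
    · exact if_neg (not_le.mpr h)
  have hgLip : LipschitzWith K g := by
    refine lipschitzWith_of_eq_zero_outside (LipschitzOnWith.of_dist_le_mul fun x hx y hy => ?_) hg0
    rw [hgG (by simpa using hx), hgG (by simpa using hy)]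
    exact hLip.dist_le_mul x hx y hy
  have hvol {t : ℝ} (ht0 : 0 ≤ t) (ht1 : t ≤ 1) (htK : t * K < 1) :
      ∫ x in closedBall (0 : E) r, (ContinuousLinearMap.id ℝ E + t • fderiv ℝ G x).det ∂μ =
        μ.real (closedBall 0 r) := by
    obtain ⟨hinj, himage⟩ := image_closedBall_eq hgLip hg0
      (fun x hx => by rw [hgG hx, hnorm]) ht0 ht1 htK
    have hEq : EqOn (fun x => x + t • G x) (fun x => x + t • g x) (closedBall 0 r) :=
      fun x hx => by simp only [hgG (mem_closedBall_zero_iff.mp hx)]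
    have h1 := integral_image_eq_integral_abs_det_fderiv_smul (F := ℝ) μ
      (measurableSet_closedBall (x := (0 : E)) (ε := r))
      (f := fun x => x + t • G x) (f' := fun x => ContinuousLinearMap.id ℝ E + t • fderiv ℝ G x)
      (fun x _ => ((hasFDerivAt_id x).add ((hderiv x).const_smul t)).hasFDerivWithinAt)
      (hinj.injOn.congr hEq.symm) (fun _ => 1)
    rw [hEq.image_eq, himage] at h1
    simp only [integral_const, smul_eq_mul, mul_one, measureReal_restrict_apply_univ] at h1
    rw [h1]
    refine setIntegral_congr_fun measurableSet_closedBall fun x hx => ?_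
    refine (abs_of_pos (det_id_add_pos ?_)).symm
    rw [norm_smul, Real.norm_eq_abs, abs_of_nonneg ht0]
    exact (mul_le_mul_of_nonneg_left (hK x hx) ht0).trans_lt htK
  -- small interpolation nodes
  let node : ℕ → ℝ := fun k => 1 / ((K + 1) * (k + 1))
  have hnode (k : ℕ) : 0 ≤ node k ∧ node k ≤ 1 ∧ node k * K < 1 := by
    have hK0 : (0 : ℝ) ≤ K := K.coe_nonneg
    have hk : (0 : ℝ) ≤ k := Nat.cast_nonneg k
    have hpos : (0 : ℝ) < (K + 1) * (k + 1) := by positivity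
    refine ⟨by positivity, ?_, ?_⟩
    · rw [div_le_one hpos]; nlinarith
    · rw [div_mul_eq_mul_div, one_mul, div_lt_one hpos]; nlinarith
  have hnode_inj : Function.Injective node := by
    intro k l hkl
    have hK0 : (K : ℝ) + 1 ≠ 0 := by positivity
    simp only [node, one_div, inv_inj] at hkl
    exact_mod_cast add_right_cancel (mul_left_cancel₀ hK0 hkl)
  obtain ⟨c, hc1, hc⟩ := exists_det_interpolation (E := E)
    ((Finset.range (Module.finrank ℝ E + 1)).image node)
    (by rw [Finset.card_image_of_injective _ hnode_inj, Finset.card_range]; omega)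
  have hint (t : ℝ) : IntegrableOn
      (fun x => c t * (ContinuousLinearMap.id ℝ E + t • fderiv ℝ G x).det) (closedBall 0 r) μ := by
    refine ContinuousOn.integrableOn_compact hcompact (Continuous.continuousOn ?_)
    exact continuous_const.mul (ContinuousLinearMap.continuous_det.comp (by fun_prop))
  have hone : ∫ x in closedBall (0 : E) r, (ContinuousLinearMap.id ℝ E + fderiv ℝ G x).det ∂μ =
      μ.real (closedBall 0 r) := by
    rw [show (fun x => (ContinuousLinearMap.id ℝ E + fderiv ℝ G x).det) = _ from
      funext fun x => hc (fderiv ℝ G x), integral_finsetSum _ fun t _ => hint t]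
    calc _ = ∑ t ∈ (Finset.range (Module.finrank ℝ E + 1)).image node,
          c t * μ.real (closedBall 0 r) := by
          refine Finset.sum_congr rfl fun t ht => ?_
          obtain ⟨k, -, rfl⟩ := Finset.mem_image.mp ht
          rw [integral_const_mul, hvol (hnode k).1 (hnode k).2.1 (hnode k).2.2]
      _ = _ := by rw [← Finset.sum_mul, hc1, one_mul]
  have hsing (x : E) : (ContinuousLinearMap.id ℝ E + fderiv ℝ G x).det = 0 := by
    by_contra hdet
    have hR : HasFDerivAt (fun x => x + G x) (ContinuousLinearMap.id ℝ E + fderiv ℝ G x) x :=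
      (hasFDerivAt_id x).add (hderiv x)
    obtain ⟨v, hv⟩ : ∃ v, (ContinuousLinearMap.id ℝ E + fderiv ℝ G x) v = x + G x := by
      have hu := LinearMap.isUnit_iff_isUnit_det _ |>.mpr (isUnit_iff_ne_zero.mpr hdet)
      exact ((Module.End.isUnit_iff _).mp hu).2 _
    have h1 := hR.norm_sq
    have h2 : HasFDerivAt (fun x => ‖x + G x‖ ^ 2) (0 : E →L[ℝ] ℝ) x := by
      simp only [hnorm]
      exact hasFDerivAt_const _ _
    have h3 := congrArg (fun A : E →L[ℝ] ℝ => A v) (h1.unique h2)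
    simp only [smul_apply, ContinuousLinearMap.comp_apply, hv,
      zero_apply, innerSL_apply_apply, real_inner_self_eq_norm_sq, hnorm] at h3
    have : 0 < r ^ 2 := by positivity
    simp at h3
    exact hr.ne' h3
  simp only [hsing, integral_zero] at hone
  have hpos : 0 < μ.real (closedBall (0 : E) r) :=
    ENNReal.toReal_pos (measure_closedBall_pos μ 0 hr).ne' hcompact.measure_lt_top.ne
  exact hpos.ne hone

/-- Spheres are not contractible. A contraction would extend the identity of the sphere to a map
from the ball to the sphere, and smoothing that map would yield a `C¹` retraction. -/
theorem not_contractibleSpace_sphere : ¬ ContractibleSpace (sphere (0 : E) 1) := by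
  intro hcontr
  classical
  obtain ⟨c, ⟨H⟩⟩ := id_nullhomotopic (sphere (0 : E) 1)
  let n : E → sphere (0 : E) 1 := fun x =>
    if h : x = 0 then c else ⟨‖x‖⁻¹ • x, by
      rw [mem_sphere_zero_iff_norm, norm_smul, norm_inv, norm_norm,
        inv_mul_cancel₀ (norm_ne_zero_iff.mpr h)]⟩
  have hn {x : E} (hx : x ≠ 0) : (n x : E) = ‖x‖⁻¹ • x := by simp only [n, dif_neg hx]
  let τ : E → unitInterval := fun x => projIcc 0 1 zero_le_one (2 - 2 * ‖x‖)
  have hτ : Continuous τ := continuous_projIcc.comp (by fun_prop)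
  -- on the inner half of the ball, the contraction is complete
  have hin {x : E} (hx : ‖x‖ ≤ 1 / 2) : H (τ x, n x) = c := by
    have : τ x = 1 := projIcc_of_right_le zero_le_one (by linarith)
    rw [this, H.apply_one]
    rfl
  have hout {x : E} (hx : 1 ≤ ‖x‖) : H (τ x, n x) = n x := by
    have : τ x = 0 := projIcc_of_le_left zero_le_one (by linarith)
    rw [this, H.apply_zero]
    rfl
  have hcont : Continuous fun x => H (τ x, n x) := by
    rw [continuous_iff_continuousAt]
    intro x
    by_cases hx : x = 0
    · subst hx
      refine (continuousAt_const (y := c)).congr ?_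
      filter_upwards [ball_mem_nhds (0 : E) (by norm_num : (0 : ℝ) < 1 / 2)] with y hy
      exact (hin (by simpa using (mem_ball_zero_iff.mp hy).le)).symm
    · refine H.continuous.continuousAt.comp (hτ.continuousAt.prodMk ?_)
      rw [Topology.IsInducing.subtypeVal.continuousAt_iff]
      have h1 : ContinuousAt (fun y : E => ‖y‖⁻¹ • y) x :=
        (continuousAt_id.norm.inv₀ (norm_ne_zero_iff.mpr hx)).smul continuousAt_id
      refine h1.congr ?_
      filter_upwards [isOpen_ne.mem_nhds hx] with y hy
      exact (hn hy).symm
  -- the displacement of a map `x ↦ x + u x` that avoids the open unit ball and is the identity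
  -- outside the unit ball; it is smoothed to a map that still avoids `0`
  let u : E → E := fun x => max 1 ‖x‖ • (H (τ x, n x) : E) - x
  have hu : Continuous u :=
    ((continuous_const.max continuous_norm).smul (continuous_subtype_val.comp hcont)).sub
      continuous_id
  have hu0 {x : E} (hx : 1 ≤ ‖x‖) : u x = 0 := by
    have hx0 : x ≠ 0 := by rintro rfl; norm_num at hx
    simp only [u]
    rw [hout hx, hn hx0, max_eq_right hx, smul_inv_smul₀ (norm_ne_zero_iff.mpr hx0), sub_self]
  have hxu (x : E) : 1 ≤ ‖x + u x‖ := by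
    simp only [u, add_sub_cancel]
    rw [norm_smul, mem_sphere_zero_iff_norm.mp (H (τ x, n x)).2, mul_one, Real.norm_eq_abs]
    exact (le_max_left 1 ‖x‖).trans (le_abs_self _)
  obtain ⟨g, hg⟩ := exists_contMDiffMap_forall_mem_convex_of_local_const (n := ⊤)
    (modelWithCornersSelf ℝ E) (F := E)
    (t := fun x => ball (u x) (1 / 2) ∩ {y | 2 ≤ ‖x‖ → y = 0}) (fun x => by
      refine (convex_ball _ _).inter ?_
      intro y hy z hz a b _ _ _ hx
      simp [hy hx, hz hx]) (fun x => by
      rcases lt_or_ge ‖x‖ 2 with hx | hx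
      · refine ⟨u x, ?_⟩
        filter_upwards [hu.continuousAt (ball_mem_nhds (u x) (by norm_num : (0 : ℝ) < 1 / 2)),
          (isOpen_lt continuous_norm continuous_const).mem_nhds hx] with y hy hy2
        exact ⟨by rw [mem_ball, dist_comm]; exact hy, fun h => absurd hy2 (not_lt.mpr h)⟩
      · refine ⟨0, ?_⟩
        filter_upwards [(isOpen_lt continuous_const continuous_norm).mem_nhds
          (show 1 < ‖x‖ by linarith)] with y hy
        refine ⟨?_, fun _ => rfl⟩
        rw [hu0 (le_of_lt hy)]
        exact mem_ball_self (by norm_num))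
  have hgs : ContDiff ℝ 1 g := g.contMDiff.contDiff.of_le (by simp)
  have hF (x : E) : x + g x ≠ 0 := by
    intro h
    have h1 := (hg x).1
    rw [mem_ball, dist_eq_norm] at h1
    have h2 : ‖x + u x‖ ≤ ‖x + g x‖ + ‖g x - u x‖ := by
      have : x + u x = (x + g x) - (g x - u x) := by abel
      rw [this]; exact norm_sub_le _ _
    rw [h, norm_zero] at h2
    linarith [hxu x]
  have hFs : ContDiff ℝ 1 fun x => x + g x := contDiff_id.add hgs
  refine not_contDiff_retraction (r := 2) (G := fun x => (2 / ‖x + g x‖) • (x + g x) - x)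
    zero_lt_two ?_ ?_ ?_
  · exact ((contDiff_const.div (hFs.norm ℝ hF) fun x => norm_ne_zero_iff.mpr (hF x)).smul hFs).sub
      contDiff_id
  · intro x hx
    simp only [(hg x).2 hx.ge, add_zero, hx]
    simp
  · intro x
    rw [add_sub_cancel, norm_smul, norm_div, norm_norm, Real.norm_ofNat,
      div_mul_cancel₀ _ (norm_ne_zero_iff.mpr (hF x))]

end Sphere

end SubwordComplex

theorem mainTheorem2 {B W : Type*} [Group W] [Finite W] {M : CoxeterMatrix B}
    (cs : CoxeterSystem M W) (Q : List B) (w : W)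
    (hsph : SubwordComplex.IsSpherical (SubwordComplex.subwordComplex cs Q w)) :
    SubwordComplex.StronglyVertexDecomposable (SubwordComplex.subwordComplex cs Q w) ∧
      SubwordComplex.StronglyShellable (SubwordComplex.subwordComplex cs Q w) := by
  open SubwordComplex in
  set L := (List.finRange Q.length).map fun i => (i, Q.get i)
  have hL := subwordComplex_eq_wordComplex (cs := cs) Q w
  have hfst : L.map Prod.fst = List.finRange Q.length := by
    simp only [L, List.map_map]
    exact List.map_id _
  have hnd : (L.map Prod.fst).Nodup := hfst ▸ List.nodup_finRange _
  suffices h : StronglyVertexDecomposable (subwordComplex cs Q w) from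
    ⟨h, fun I hI => ⟨(h I hI).1.shellable, (h I hI).2.shellable⟩⟩
  intro I hI
  rw [hL] at hI hsph ⊢
  have hcon : ContainsReduced cs (L.map Prod.snd) w := hI.2.mono (List.filter_sublist.map _)
  have hdem : demazureProd cs (L.map Prod.snd) = w := by
    by_contra hne
    obtain ⟨d, ⟨e⟩⟩ := hsph
    have := (collapsible_wordComplex L w hnd hcon hne).contractibleSpace_realization
    exact not_contractibleSpace_sphere e.symm.contractibleSpace
  refine ⟨vertexDecomposable_costar_wordComplex hnd (fun ω hω => ?_) hI,
    vertexDecomposable_star_wordComplex hnd hI⟩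
  have h := (wordProd_bruhatLE_demazureProd cs _ ω hω).length_le
  rwa [hdem] at h
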